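/- Let $a>0$, $b\in\mathbb R\setminus\{0\}$, $\gamma>0$, $0<\alpha<1$ and $\eta\ge 0$; put $\kappa(\alpha)=\frac{\sin(\alpha\pi)}{\pi}$ and $\mu(\xi)=|\xi|^{\frac{2\alpha-1}{2}}$ for $\xi\in\mathbb R$. Let $H^1_L(0,1)=\{u\in H^1(0,1): u(0)=0\}$ and let $$\mathcal H=H^1_L(0,1)\times L^2(0,1)\times H^1_0(0,1)\times L^2(0,1)\times L^2(\mathbb R)$$ (complex-valued functions) be equipped with the inner product $$\langle (u,v,y,z,\omega),(\tilde u,\tilde v,\tilde y,\tilde z,\tilde\omega)\rangle_{\mathcal H}=\int_0^1\left(v\overline{\tilde v}+u_x\overline{\tilde u_x}+z\overline{\tilde z}+a\,y_x\overline{\tilde y_x}\right)dx+\gamma\kappa(\alpha)\int_{\mathbb R}\omega\,\overline{\tilde\omega}\,d\xi .$$ Let $\mathcal A$ be the operator $$\mathcal A(u,v,y,z,\omega)=\left(v,\;u_{xx}-bz,\;z,\;a\,y_{xx}+bv,\;-(\xi^2+\eta)\omega+v(1)\mu(\xi)\right)$$ whose domain $D(\mathcal A)$ consists of all $(u,v,y,z,\omega)\in\mathcal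 H$ with $u\in H^2(0,1)\cap H^1_L(0,1)$, $y\in H^2(0,1)\cap H^1_0(0,1)$, $v\in H^1_L(0,1)$, $z\in H^1_0(0,1)$, $-(\xi^2+\eta)\omega+v(1)\mu(\xi)\in L^2(\mathbb R)$, $|\xi|\omega\in L^2(\mathbb R)$ and $$u_x(1)+\gamma\kappa(\alpha)\int_{\mathbb R}\mu(\xi)\omega(\xi)\,d\xi=0 .$$ Assume that $a\neq 1$ and that condition (SC) holds: $$b^2\neq\frac{(k_1^2-ak_2^2)(ak_1^2-k_2^2)}{(a+1)(k_1^2+k_2^2)}\,\pi^2\qquad\text{for all }(k_1,k_2)\in\mathbb Z^2\setminus\{(0,0)\}.$$ Then $\mathcal A$ generates a $C_0$-semigroup of contractions $e^{t\mathcal A}$ on $\mathcal H$, and this semigroup is not uniformly (exponentially) stable: there are no constants $M\in\mathbb R$ and $\delta>0$ with $\|e^{t\mathcal A}\|\le M e^{-\delta t}$ for all $t\ge 0$. -/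

import Mathlib

open MeasureTheory Set Filter Topology
open scoped NNReal ContDiff ComplexConjugate

noncomputable section

namespace CoupledWave

/-! ### Sobolev spaces on the interval `(0,1)` -/

/-- The complex space `L²(0,1)`. -/
abbrev L2I : Type := Lp ℂ 2 (volume.restrict (Ioo (0 : ℝ) 1))

/-- The complex space `L²(ℝ)`. -/
abbrev L2R : Type := Lp ℂ 2 (volume : Measure ℝ)

/-- `p ∈ L²(0,1)` is a weak derivative of `u ∈ L²(0,1)`: `∫ φ' u = - ∫ φ p` for every
`φ ∈ C_c^∞(0,1)`. (Real test functions suffice, as both sides are linear in `φ`.) -/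
def IsWeakDeriv (u p : L2I) : Prop :=
  ∀ φ : ℝ → ℝ, ContDiff ℝ ∞ φ → HasCompactSupport φ → tsupport φ ⊆ Ioo 0 1 →
    ∫ x in Ioo (0 : ℝ) 1, deriv φ x • u x = - ∫ x in Ioo (0 : ℝ) 1, φ x • p x

/-- `f` is a representative of the class `u` that is continuous on the closed interval `[0,1]`. -/
def IsContRep (u : L2I) (f : ℝ → ℂ) : Prop :=
  ContinuousOn f (Icc 0 1) ∧ f =ᵐ[volume.restrict (Ioo (0 : ℝ) 1)] u

open Classical in
/-- The weak derivative `u_x` of `u` (the value is `0` if there is none). -/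
def weakDeriv (u : L2I) : L2I :=
  if h : ∃ p, IsWeakDeriv u p then h.choose else 0

open Classical in
/-- The value at `c ∈ [0,1]` of the continuous representative of `u` on `[0,1]`
(the value is `0` if there is none). -/
def pointValue (u : L2I) (c : ℝ) : ℂ :=
  if h : ∃ f, IsContRep u f then h.choose c else 0

/-! #### Facts on weak derivatives and continuous representatives -/

theorem L2I.integrableOn (u : L2I) : IntegrableOn u (Ioo (0 : ℝ) 1) :=
  (Lp.memLp u).integrable (by norm_num)

theorem integrableOn_smul_of_continuous {φ : ℝ → ℝ} (hφ : Continuous φ) (u : L2I) :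
    IntegrableOn (fun x => φ x • u x) (Ioo (0 : ℝ) 1) := by
  obtain ⟨C, hC⟩ := (isCompact_Icc (a := (0 : ℝ)) (b := 1)).exists_bound_of_continuousOn
    hφ.continuousOn
  refine Integrable.bdd_smul (L2I.integrableOn u) C hφ.aestronglyMeasurable ?_
  filter_upwards [ae_restrict_mem measurableSet_Ioo] with x hx
  exact hC x (Ioo_subset_Icc_self hx)

theorem eq_of_forall_integral_smul_eq {u v : L2I}
    (h : ∀ φ : ℝ → ℝ, ContDiff ℝ ∞ φ → HasCompactSupport φ → tsupport φ ⊆ Ioo 0 1 →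
      ∫ x in Ioo (0 : ℝ) 1, φ x • u x = ∫ x in Ioo (0 : ℝ) 1, φ x • v x) : u = v := by
  apply Lp.ext
  have hl : LocallyIntegrableOn (fun x => u x - v x) (Ioo (0 : ℝ) 1) :=
    ((L2I.integrableOn u).sub (L2I.integrableOn v)).locallyIntegrableOn
  have := isOpen_Ioo.ae_eq_zero_of_integral_contDiff_smul_eq_zero (μ := volume) hl ?_
  · rw [EventuallyEq, ae_restrict_iff' measurableSet_Ioo]
    filter_upwards [this] with x hx hx'
    exact sub_eq_zero.1 (hx hx')
  · intro φ h1 h2 h3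
    rw [← setIntegral_eq_integral_of_forall_compl_eq_zero (s := Ioo (0 : ℝ) 1)]
    · simp only [smul_sub]
      rw [integral_sub (integrableOn_smul_of_continuous h1.continuous u)
        (integrableOn_smul_of_continuous h1.continuous v), h φ h1 h2 h3, sub_self]
    · intro x hx
      rw [image_eq_zero_of_notMem_tsupport (fun hx' => hx (h3 hx')), zero_smul]

theorem IsWeakDeriv.unique {u p q : L2I} (hp : IsWeakDeriv u p) (hq : IsWeakDeriv u q) :
    p = q :=
  eq_of_forall_integral_smul_eq fun φ h1 h2 h3 =>
    neg_injective ((hp φ h1 h2 h3).symm.trans (hq φ h1 h2 h3))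

theorem IsWeakDeriv.weakDeriv_eq {u p : L2I} (h : IsWeakDeriv u p) : weakDeriv u = p := by
  have h' : ∃ p, IsWeakDeriv u p := ⟨p, h⟩
  rw [weakDeriv, dif_pos h']
  exact h'.choose_spec.unique h

theorem integral_smul_add {φ : ℝ → ℝ} (hφ : Continuous φ) (u v : L2I) :
    ∫ x in Ioo (0 : ℝ) 1, φ x • (u + v : L2I) x =
      (∫ x in Ioo (0 : ℝ) 1, φ x • u x) + ∫ x in Ioo (0 : ℝ) 1, φ x • v x := by
  rw [← integral_add (integrableOn_smul_of_continuous hφ u)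
    (integrableOn_smul_of_continuous hφ v)]
  refine integral_congr_ae ?_
  filter_upwards [Lp.coeFn_add u v] with x hx
  rw [hx, Pi.add_apply, smul_add]

theorem integral_smul_smul (φ : ℝ → ℝ) (c : ℂ) (u : L2I) :
    ∫ x in Ioo (0 : ℝ) 1, φ x • (c • u : L2I) x = c • ∫ x in Ioo (0 : ℝ) 1, φ x • u x := by
  rw [← integral_smul]
  refine integral_congr_ae ?_
  filter_upwards [Lp.coeFn_smul c u] with x hx
  rw [hx, Pi.smul_apply, smul_comm]

theorem IsWeakDeriv.add {u v p q : L2I} (hu : IsWeakDeriv u p) (hv : IsWeakDeriv v q) :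
    IsWeakDeriv (u + v) (p + q) := by
  intro φ h1 h2 h3
  rw [integral_smul_add (h1.continuous_deriv (by simp)), integral_smul_add h1.continuous,
    hu φ h1 h2 h3, hv φ h1 h2 h3, neg_add]

theorem IsWeakDeriv.smul {u p : L2I} (c : ℂ) (hu : IsWeakDeriv u p) :
    IsWeakDeriv (c • u) (c • p) := by
  intro φ h1 h2 h3
  rw [integral_smul_smul, integral_smul_smul, hu φ h1 h2 h3, smul_neg]

theorem isWeakDeriv_zero : IsWeakDeriv 0 0 := by
  simpa using IsWeakDeriv.smul (u := 0) (p := 0) 0 (by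
    intro φ _ _ _
    have h : ∀ ψ : ℝ → ℝ, ∫ x in Ioo (0 : ℝ) 1, ψ x • (0 : L2I) x = 0 := by
      intro ψ
      rw [integral_eq_zero_of_ae]
      filter_upwards [Lp.coeFn_zero ℂ 2 (volume.restrict (Ioo (0 : ℝ) 1))] with x hx
      rw [hx]
      exact smul_zero _
    rw [h, h, neg_zero])

theorem continuousOn_primitive (p : L2I) :
    ContinuousOn (fun x => ∫ t in (0 : ℝ)..x, p t) (Icc 0 1) := by
  have hp : IntegrableOn p (Icc (0 : ℝ) 1) := by
    rw [integrableOn_Icc_iff_integrableOn_Ioo]; exact L2I.integrableOn p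
  have := intervalIntegral.continuousOn_primitive_interval (a := (0 : ℝ)) (b := 1) (f := p)
    (μ := volume) (by simpa [uIcc_of_le (zero_le_one (α := ℝ))] using hp)
  simpa [uIcc_of_le (zero_le_one (α := ℝ))] using this

/-- Integration by parts against a primitive of an `L²` function. -/
theorem integral_deriv_smul_primitive {φ : ℝ → ℝ} (h1 : ContDiff ℝ ∞ φ)
    (h3 : tsupport φ ⊆ Ioo 0 1) (p : L2I) :
    ∫ x in Ioo (0 : ℝ) 1, deriv φ x • ∫ t in (0 : ℝ)..x, p t =
      - ∫ x in Ioo (0 : ℝ) 1, φ x • p x := by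
  have hφ1 : φ 1 = 0 := image_eq_zero_of_notMem_tsupport fun h => by simpa using h3 h
  have hφ1' : ContDiffOn ℝ 1 φ (uIcc (0 : ℝ) 1) := (h1.of_le (by simp)).contDiffOn
  have hφac : AbsolutelyContinuousOnInterval φ 0 1 := hφ1'.absolutelyContinuousOnInterval
  have hreal : ∀ q : ℝ → ℝ, IntegrableOn q (Ioo (0 : ℝ) 1) →
      ∫ x in (0 : ℝ)..1, deriv φ x * ∫ t in (0 : ℝ)..x, q t = - ∫ x in (0 : ℝ)..1, φ x * q x := by
    intro q hq
    have hq' : IntervalIntegrable q volume 0 1 := by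
      rw [intervalIntegrable_iff_integrableOn_Ioo_of_le zero_le_one]; exact hq
    have hac := hq'.absolutelyContinuousOnInterval_intervalIntegral (c := 0) (by simp)
    have := hφac.integral_mul_deriv_eq_deriv_mul hac
    rw [hφ1, intervalIntegral.integral_same, zero_mul, mul_zero, sub_zero, zero_sub] at this
    have e : ∫ x in (0 : ℝ)..1, φ x * q x =
        ∫ x in (0 : ℝ)..1, φ x * deriv (fun y => ∫ t in (0 : ℝ)..y, q t) x := by
      refine intervalIntegral.integral_congr_ae ?_
      filter_upwards [hq'.ae_hasDerivAt_integral] with x hx hx'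
      rw [(hx (uIoc_subset_uIcc hx') 0 (by simp)).deriv]
    rw [e, this, neg_neg]
  have hp : IntegrableOn p (Ioo (0 : ℝ) 1) := L2I.integrableOn p
  have hpi : ∀ x ∈ Icc (0 : ℝ) 1, IntervalIntegrable p volume 0 x := by
    intro x hx
    rw [intervalIntegrable_iff_integrableOn_Ioo_of_le hx.1]
    exact hp.mono_set (Ioo_subset_Ioo_right hx.2)
  have hP := continuousOn_primitive p
  have hi1 : IntegrableOn (fun x => deriv φ x • ∫ t in (0 : ℝ)..x, p t) (Ioo (0 : ℝ) 1) :=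
    (((h1.continuous_deriv (by simp)).continuousOn.smul hP).integrableOn_compact
      isCompact_Icc).mono_set Ioo_subset_Icc_self
  have hi2 := integrableOn_smul_of_continuous h1.continuous p
  have key : ∀ L : ℂ →L[ℝ] ℝ, L (∫ x in Ioo (0 : ℝ) 1, deriv φ x • ∫ t in (0 : ℝ)..x, p t) =
      L (- ∫ x in Ioo (0 : ℝ) 1, φ x • p x) := by
    intro L
    rw [map_neg, ← L.integral_comp_comm hi1, ← L.integral_comp_comm hi2]
    have := hreal (fun t => L (p t)) (L.integrable_comp hp)
    rw [intervalIntegral.integral_of_le zero_le_one, intervalIntegral.integral_of_le zero_le_one,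
      integral_Ioc_eq_integral_Ioo, integral_Ioc_eq_integral_Ioo] at this
    simp only [map_smul, smul_eq_mul]
    rw [← this]
    refine setIntegral_congr_fun measurableSet_Ioo fun x hx => ?_
    rw [L.intervalIntegral_comp_comm (hpi x (Ioo_subset_Icc_self hx))]
  exact Complex.ext (key Complex.reCLM) (key Complex.imCLM)

/-- A function with weak derivative `p` is, up to a constant, the primitive of `p`. -/
theorem IsWeakDeriv.exists_const {u p : L2I} (h : IsWeakDeriv u p) :
    ∃ c : ℂ, IsContRep u (fun x => c + ∫ t in (0 : ℝ)..x, p t) := by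
  set P : ℝ → ℂ := fun x => ∫ t in (0 : ℝ)..x, p t with hPdef
  have hPc : ContinuousOn P (Icc 0 1) := continuousOn_primitive p
  set w : ℝ → ℂ := fun x => u x - P x with hwdef
  have hPi : ∀ φ : ℝ → ℝ, Continuous φ → IntegrableOn (fun x => φ x • P x) (Ioo (0 : ℝ) 1) :=
    fun φ hφ => ((hφ.continuousOn.smul hPc).integrableOn_compact isCompact_Icc).mono_set
      Ioo_subset_Icc_self
  have hwi : ∀ φ : ℝ → ℝ, Continuous φ → IntegrableOn (fun x => φ x • w x) (Ioo (0 : ℝ) 1) := by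
    intro φ hφ
    simp only [hwdef, smul_sub]
    exact (integrableOn_smul_of_continuous hφ u).sub (hPi φ hφ)
  have hw : ∀ φ : ℝ → ℝ, ContDiff ℝ ∞ φ → HasCompactSupport φ → tsupport φ ⊆ Ioo 0 1 →
      ∫ x in Ioo (0 : ℝ) 1, deriv φ x • w x = 0 := by
    intro φ h1 h2 h3
    have hd : Continuous (deriv φ) := h1.continuous_deriv (by simp)
    simp only [hwdef, smul_sub]
    rw [integral_sub (integrableOn_smul_of_continuous hd u) (hPi _ hd), h φ h1 h2 h3,
      integral_deriv_smul_primitive h1 h3, sub_self]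
  let B : ContDiffBump (1 / 2 : ℝ) := ⟨1 / 8, 1 / 4, by norm_num, by norm_num⟩
  set ψ : ℝ → ℝ := B.normed volume with hψ
  have hψ1 : ContDiff ℝ ∞ ψ := B.contDiff_normed
  have hψ2 : HasCompactSupport ψ := B.hasCompactSupport_normed
  have hψ3 : tsupport ψ ⊆ Ioo 0 1 := by
    rw [hψ, B.tsupport_normed_eq, Real.closedBall_eq_Icc]
    intro x hx
    have h1 : (1 / 2 : ℝ) - 1 / 4 ≤ x := hx.1
    have h2 : x ≤ (1 / 2 : ℝ) + 1 / 4 := hx.2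
    constructor <;> linarith
  have hψint : ∫ x, ψ x = 1 := B.integral_normed
  set c : ℂ := ∫ x in Ioo (0 : ℝ) 1, ψ x • w x with hc
  have main : ∀ g : ℝ → ℝ, ContDiff ℝ ∞ g → HasCompactSupport g → tsupport g ⊆ Ioo 0 1 →
      ∫ x in Ioo (0 : ℝ) 1, g x • w x = (∫ x, g x) • c := by
    intro g g1 g2 g3
    set I : ℝ := ∫ x, g x with hI
    set k : ℝ → ℝ := fun x => g x - I * ψ x with hk
    have hk1 : ContDiff ℝ ∞ k := g1.sub (contDiff_const.mul hψ1)
    have hkc : Continuous k := hk1.continuous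
    set K : Set ℝ := tsupport g ∪ tsupport ψ ∪ {1 / 2} with hK
    have hKc : IsCompact K := (g2.isCompact.union hψ2.isCompact).union isCompact_singleton
    have hKs : K ⊆ Ioo 0 1 :=
      union_subset (union_subset g3 hψ3) (singleton_subset_iff.2 (by norm_num))
    have hKn : K.Nonempty := ⟨1 / 2, Or.inr rfl⟩
    obtain ⟨s, hsK, hs⟩ := hKc.exists_isLeast hKn
    obtain ⟨r, hrK, hr⟩ := hKc.exists_isGreatest hKn
    have hk0 : ∀ x, x ∉ Icc s r → k x = 0 := by
      intro x hx
      have hxK : x ∉ K := fun hxK => hx ⟨hs hxK, hr hxK⟩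
      simp only [hK, mem_union, not_or] at hxK
      simp only [hk]
      rw [image_eq_zero_of_notMem_tsupport hxK.1.1, image_eq_zero_of_notMem_tsupport hxK.1.2]
      ring
    have hkint : ∫ x, k x = 0 := by
      simp only [hk]
      rw [integral_sub (g1.continuous.integrable_of_hasCompactSupport g2)
        ((hψ1.continuous.integrable_of_hasCompactSupport hψ2).const_mul I),
        integral_const_mul, hψint, ← hI, mul_one, sub_self]
    set φ : ℝ → ℝ := fun x => ∫ t in (0 : ℝ)..x, k t with hφ
    have hφd : ∀ x, HasDerivAt φ (k x) x := fun x =>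
      intervalIntegral.integral_hasDerivAt_right (hkc.intervalIntegrable _ _)
        (hkc.stronglyMeasurableAtFilter _ _) hkc.continuousAt
    have hφd' : deriv φ = k := funext fun x => (hφd x).deriv
    have hφ1 : ContDiff ℝ ∞ φ := by
      rw [contDiff_infty_iff_deriv]
      exact ⟨fun x => (hφd x).differentiableAt, hφd' ▸ hk1⟩
    have hφsupp : tsupport φ ⊆ Icc s r := by
      refine closure_minimal ?_ isClosed_Icc
      intro x hx
      by_contra hxs
      apply hx
      have h0s : 0 < s := (hKs hsK).1
      have hr1 : r < 1 := (hKs hrK).2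
      rcases lt_or_ge x s with hlt | hge
      · simp only [hφ]
        refine intervalIntegral.integral_zero_ae (Eventually.of_forall fun t ht => hk0 t ?_)
        intro ht'
        have : t ≤ max 0 x := ht.2
        have h2 : max 0 x < s := max_lt h0s hlt
        linarith [ht'.1]
      · have hxr : r < x := by
          by_contra hh
          exact hxs ⟨hge, not_lt.1 hh⟩
        have hsr : s ≤ r := hs hrK
        simp only [hφ]
        rw [intervalIntegral.integral_of_le (by linarith), ← hkint]
        refine setIntegral_eq_integral_of_forall_compl_eq_zero fun t ht => hk0 t fun ht' => ht ?_
        exact ⟨by linarith [ht'.1], by linarith [ht'.2]⟩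
    have hφ2 : HasCompactSupport φ := isCompact_Icc.of_isClosed_subset (isClosed_tsupport φ) hφsupp
    have hφ3 : tsupport φ ⊆ Ioo 0 1 := hφsupp.trans fun x hx =>
      ⟨(hKs hsK).1.trans_le hx.1, hx.2.trans_lt (hKs hrK).2⟩
    have := hw φ hφ1 hφ2 hφ3
    rw [hφd'] at this
    simp only [hk, sub_smul, mul_smul] at this
    have hs2 : IntegrableOn (fun x => I • ψ x • w x) (Ioo (0 : ℝ) 1) :=
      (hwi ψ hψ1.continuous).smul I
    rw [integral_sub (hwi g g1.continuous) hs2, integral_smul, sub_eq_zero] at this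
    exact this
  have hcont : ContinuousOn (fun x => c + P x) (Icc 0 1) := continuousOn_const.add hPc
  refine ⟨c, hcont, ?_⟩
  have hl : LocallyIntegrableOn (fun x => w x - c) (Ioo (0 : ℝ) 1) := by
    have h1 : IntegrableOn w (Ioo (0 : ℝ) 1) := by simpa using hwi (fun _ => 1) continuous_const
    exact (h1.sub (integrableOn_const (by simp))).locallyIntegrableOn
  have hz := isOpen_Ioo.ae_eq_zero_of_integral_contDiff_smul_eq_zero (μ := volume) hl ?_
  · rw [EventuallyEq, ae_restrict_iff' measurableSet_Ioo]
    filter_upwards [hz] with x hx hx'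
    have : u x - P x - c = 0 := hx hx'
    linear_combination -this
  · intro g g1 g2 g3
    have hg0 : ∀ x, x ∉ Ioo (0 : ℝ) 1 → g x = 0 := fun x hx =>
      image_eq_zero_of_notMem_tsupport fun hx' => hx (g3 hx')
    rw [← setIntegral_eq_integral_of_forall_compl_eq_zero (s := Ioo (0 : ℝ) 1)
      (fun x hx => by rw [hg0 x hx, zero_smul])]
    have hgi : IntegrableOn g (Ioo (0 : ℝ) 1) :=
      (g1.continuous.integrable_of_hasCompactSupport g2).integrableOn
    simp only [smul_sub]
    rw [integral_sub (hwi g g1.continuous) (hgi.smul_const c), main g g1 g2 g3,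
      integral_smul_const, setIntegral_eq_integral_of_forall_compl_eq_zero hg0, sub_self]

theorem IsContRep.eqOn {u : L2I} {f g : ℝ → ℂ} (hf : IsContRep u f) (hg : IsContRep u g) :
    EqOn f g (Icc 0 1) := by
  refine Measure.eqOn_Icc_of_ae_eq volume zero_ne_one ?_ hf.1 hg.1
  rw [← restrict_Ioo_eq_restrict_Icc]
  exact hf.2.trans hg.2.symm

theorem IsContRep.pointValue_eq {u : L2I} {f : ℝ → ℂ} (hf : IsContRep u f) {c : ℝ}
    (hc : c ∈ Icc (0 : ℝ) 1) : pointValue u c = f c := by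
  have h' : ∃ f, IsContRep u f := ⟨f, hf⟩
  rw [pointValue, dif_pos h']
  exact h'.choose_spec.eqOn hf hc

theorem IsContRep.add {u v : L2I} {f g : ℝ → ℂ} (hf : IsContRep u f) (hg : IsContRep v g) :
    IsContRep (u + v) (f + g) :=
  ⟨hf.1.add hg.1, (hf.2.add hg.2).trans (Lp.coeFn_add u v).symm⟩

theorem IsContRep.smul {u : L2I} {f : ℝ → ℂ} (c : ℂ) (hf : IsContRep u f) :
    IsContRep (c • u) (c • f) :=
  ⟨hf.1.const_smul c, (hf.2.const_smul c).trans (Lp.coeFn_smul c u).symm⟩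

theorem isContRep_zero : IsContRep 0 (fun _ => 0) :=
  ⟨continuousOn_const, (Lp.coeFn_zero ℂ 2 _).symm⟩

/-! #### The spaces `H¹(0,1)`, `H¹_L(0,1)` and `H¹₀(0,1)` -/

/-- `H¹(0,1)`: the functions in `L²(0,1)` with a weak derivative in `L²(0,1)`. -/
def H1 : Submodule ℂ L2I where
  carrier := {u | ∃ p, IsWeakDeriv u p}
  add_mem' := fun ⟨p, hp⟩ ⟨q, hq⟩ => ⟨p + q, hp.add hq⟩
  zero_mem' := ⟨0, isWeakDeriv_zero⟩
  smul_mem' := fun c _ ⟨p, hp⟩ => ⟨c • p, hp.smul c⟩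

theorem H1.isWeakDeriv {u : L2I} (hu : u ∈ H1) : IsWeakDeriv u (weakDeriv u) := by
  obtain ⟨p, hp⟩ := hu
  rwa [hp.weakDeriv_eq]

theorem weakDeriv_add {u v : L2I} (hu : u ∈ H1) (hv : v ∈ H1) :
    weakDeriv (u + v) = weakDeriv u + weakDeriv v :=
  ((H1.isWeakDeriv hu).add (H1.isWeakDeriv hv)).weakDeriv_eq

theorem weakDeriv_smul {u : L2I} (c : ℂ) (hu : u ∈ H1) :
    weakDeriv (c • u) = c • weakDeriv u :=
  ((H1.isWeakDeriv hu).smul c).weakDeriv_eq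

/-- The fundamental theorem of calculus in `H¹(0,1)`. -/
theorem H1.isContRep {u : L2I} (hu : u ∈ H1) :
    IsContRep u (fun x => pointValue u 0 + ∫ t in (0 : ℝ)..x, weakDeriv u t) := by
  obtain ⟨c, hc⟩ := (H1.isWeakDeriv hu).exists_const
  have : pointValue u 0 = c := by rw [hc.pointValue_eq (by simp)]; simp
  rwa [this]

theorem pointValue_add {u v : L2I} (hu : u ∈ H1) (hv : v ∈ H1) {c : ℝ}
    (hc : c ∈ Icc (0 : ℝ) 1) : pointValue (u + v) c = pointValue u c + pointValue v c := by
  have hu' := H1.isContRep hu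
  have hv' := H1.isContRep hv
  rw [(hu'.add hv').pointValue_eq hc, hu'.pointValue_eq hc, hv'.pointValue_eq hc, Pi.add_apply]

theorem pointValue_smul {u : L2I} (k : ℂ) (hu : u ∈ H1) {c : ℝ} (hc : c ∈ Icc (0 : ℝ) 1) :
    pointValue (k • u) c = k * pointValue u c := by
  have hu' := H1.isContRep hu
  rw [(hu'.smul k).pointValue_eq hc, hu'.pointValue_eq hc, Pi.smul_apply, smul_eq_mul]

theorem pointValue_zero {c : ℝ} (hc : c ∈ Icc (0 : ℝ) 1) : pointValue 0 c = 0 :=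
  isContRep_zero.pointValue_eq hc

/-- `H¹_L(0,1) = {u ∈ H¹(0,1) : u(0) = 0}`. -/
def H1L : Submodule ℂ L2I where
  carrier := {u | u ∈ H1 ∧ pointValue u 0 = 0}
  add_mem' := fun {u v} hu hv => ⟨H1.add_mem hu.1 hv.1, by
    rw [pointValue_add hu.1 hv.1 (by simp), hu.2, hv.2, add_zero]⟩
  zero_mem' := ⟨H1.zero_mem, pointValue_zero (by simp)⟩
  smul_mem' := fun c u hu => ⟨H1.smul_mem c hu.1, by
    rw [pointValue_smul c hu.1 (by simp), hu.2, mul_zero]⟩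

/-- `H¹₀(0,1) = {y ∈ H¹(0,1) : y(0) = y(1) = 0}`. -/
def H10 : Submodule ℂ L2I where
  carrier := {y | y ∈ H1 ∧ pointValue y 0 = 0 ∧ pointValue y 1 = 0}
  add_mem' := fun {u v} hu hv => ⟨H1.add_mem hu.1 hv.1, by
    rw [pointValue_add hu.1 hv.1 (by simp), hu.2.1, hv.2.1, add_zero], by
    rw [pointValue_add hu.1 hv.1 (by simp), hu.2.2, hv.2.2, add_zero]⟩
  zero_mem' := ⟨H1.zero_mem, pointValue_zero (by simp), pointValue_zero (by simp)⟩
  smul_mem' := fun c u hu => ⟨H1.smul_mem c hu.1, by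
    rw [pointValue_smul c hu.1 (by simp), hu.2.1, mul_zero], by
    rw [pointValue_smul c hu.1 (by simp), hu.2.2, mul_zero]⟩

theorem H10_le_H1L : H10 ≤ H1L := fun _ h => ⟨h.1, h.2.1⟩

theorem H1L_eq_zero {u : L2I} (hu : u ∈ H1L) (h : weakDeriv u = 0) : u = 0 := by
  have h1 := (H1.isContRep hu.1).2
  apply Lp.ext
  refine h1.symm.trans (EventuallyEq.trans ?_ (Lp.coeFn_zero ℂ 2 _).symm)
  filter_upwards [ae_restrict_mem measurableSet_Ioo] with x hx
  rw [hu.2, h, zero_add, Pi.zero_apply]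
  rw [intervalIntegral.integral_of_le hx.1.le, integral_Ioc_eq_integral_Ioo]
  refine integral_eq_zero_of_ae ?_
  exact ae_mono (Measure.restrict_mono (Ioo_subset_Ioo_right hx.2.le) le_rfl)
    (Lp.coeFn_zero ℂ 2 (volume.restrict (Ioo (0 : ℝ) 1)))

/-! ### The energy space -/

/-- The coefficients of the system: the wave speed ratio `a > 0`, the coupling `b ≠ 0`, the
damping coefficient `γ > 0`, and the parameters `0 < α < 1`, `η ≥ 0` of the fractional
derivative. -/
structure Params where
  a : ℝ
  b : ℝ
  γ : ℝ
  α : ℝ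
  η : ℝ
  a_pos : 0 < a
  b_ne_zero : b ≠ 0
  γ_pos : 0 < γ
  α_pos : 0 < α
  α_lt_one : α < 1
  η_nonneg : 0 ≤ η

/-- The constant `γ κ(α)`, with `κ(α) = sin(απ) / π`. -/
def Params.γκ (P : Params) : ℝ := P.γ * (Real.sin (P.α * Real.pi) / Real.pi)

/-- The function `μ(ξ) = |ξ|^{(2α-1)/2}`. -/
def Params.μ (P : Params) (ξ : ℝ) : ℝ := |ξ| ^ ((2 * P.α - 1) / 2)

/-- The condition (SC): `b² ≠ (k₁² - a k₂²)(a k₁² - k₂²) / ((a + 1)(k₁² + k₂²)) π²` for all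
integers `k₁`, `k₂` that do not both vanish. -/
def Params.SC (P : Params) : Prop :=
  ∀ k₁ k₂ : ℤ, ¬ (k₁ = 0 ∧ k₂ = 0) →
    P.b ^ 2 ≠ (((k₁ : ℝ) ^ 2 - P.a * (k₂ : ℝ) ^ 2) * (P.a * (k₁ : ℝ) ^ 2 - (k₂ : ℝ) ^ 2)) /
      ((P.a + 1) * ((k₁ : ℝ) ^ 2 + (k₂ : ℝ) ^ 2)) * Real.pi ^ 2

theorem Params.γκ_pos (P : Params) : 0 < P.γκ := by
  refine mul_pos P.γ_pos (div_pos (Real.sin_pos_of_pos_of_lt_pi ?_ ?_) Real.pi_pos)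
  · exact mul_pos P.α_pos Real.pi_pos
  · nlinarith [P.α_lt_one, Real.pi_pos]

/-- The energy space `H = H¹_L(0,1) × L²(0,1) × H¹₀(0,1) × L²(0,1) × L²(ℝ)`. Its inner product
depends on the coefficients. (The field `w` is the component `ω`.) -/
@[ext]
structure Energy (P : Params) where
  u : H1L
  v : L2I
  y : H10
  z : L2I
  w : L2R

namespace Energy

variable {P : Params}

/-- The underlying product space, used only to transport the vector space structure. -/
def equivProd (P : Params) : Energy P ≃ H1L × L2I × H10 × L2I × L2R where
  toFun U := (U.u, U.v, U.y, U.z, U.w)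
  invFun U := ⟨U.1, U.2.1, U.2.2.1, U.2.2.2.1, U.2.2.2.2⟩
  left_inv _ := rfl
  right_inv _ := rfl

instance : AddCommGroup (Energy P) := (equivProd P).addCommGroup

instance : Module ℂ (Energy P) := (equivProd P).module ℂ

@[simp] theorem add_u (U V : Energy P) : (U + V).u = U.u + V.u := rfl
@[simp] theorem add_v (U V : Energy P) : (U + V).v = U.v + V.v := rfl
@[simp] theorem add_y (U V : Energy P) : (U + V).y = U.y + V.y := rfl
@[simp] theorem add_z (U V : Energy P) : (U + V).z = U.z + V.z := rfl
@[simp] theorem add_w (U V : Energy P) : (U + V).w = U.w + V.w := rfl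
@[simp] theorem smul_u (c : ℂ) (U : Energy P) : (c • U).u = c • U.u := rfl
@[simp] theorem smul_v (c : ℂ) (U : Energy P) : (c • U).v = c • U.v := rfl
@[simp] theorem smul_y (c : ℂ) (U : Energy P) : (c • U).y = c • U.y := rfl
@[simp] theorem smul_z (c : ℂ) (U : Energy P) : (c • U).z = c • U.z := rfl
@[simp] theorem smul_w (c : ℂ) (U : Energy P) : (c • U).w = c • U.w := rfl
@[simp] theorem zero_u : (0 : Energy P).u = 0 := rfl
@[simp] theorem zero_v : (0 : Energy P).v = 0 := rfl
@[simp] theorem zero_y : (0 : Energy P).y = 0 := rfl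
@[simp] theorem zero_z : (0 : Energy P).z = 0 := rfl
@[simp] theorem zero_w : (0 : Energy P).w = 0 := rfl

theorem re_inner_self {E : Type*} [NormedAddCommGroup E] [InnerProductSpace ℂ E] (x : E) :
    (inner ℂ x x).re = ‖x‖ ^ 2 :=
  inner_self_eq_norm_sq (𝕜 := ℂ) x

/-- The energy inner product
`∫₀¹ (v conj(v') + u_x conj(u'_x) + z conj(z') + a y_x conj(y'_x)) dx + γκ ∫_ℝ ω conj(ω') dξ`,
written with the convention that an inner product is conjugate linear in its first argument. -/
abbrev core (P : Params) : InnerProductSpace.Core ℂ (Energy P) where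
  inner U V := inner ℂ U.v V.v + inner ℂ (weakDeriv U.u) (weakDeriv V.u) + inner ℂ U.z V.z
    + (P.a : ℂ) * inner ℂ (weakDeriv U.y) (weakDeriv V.y) + (P.γκ : ℂ) * inner ℂ U.w V.w
  conj_inner_symm U V := by
    simp only [map_add, map_mul, inner_conj_symm, Complex.conj_ofReal]
  re_inner_nonneg U := by
    have := P.a_pos
    have := P.γκ_pos
    rw [RCLike.re_eq_complex_re]
    simp only [Complex.add_re, Complex.re_ofReal_mul, re_inner_self]
    positivity
  add_left U V W := by
    have h1 := weakDeriv_add U.u.2.1 V.u.2.1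
    have h2 := weakDeriv_add U.y.2.1 V.y.2.1
    simp only [add_u, add_v, add_y, add_z, add_w, Submodule.coe_add, h1, h2, inner_add_left]
    ring
  smul_left U V c := by
    have h1 := weakDeriv_smul c U.u.2.1
    have h2 := weakDeriv_smul c U.y.2.1
    simp only [smul_u, smul_v, smul_y, smul_z, smul_w, Submodule.coe_smul, h1, h2,
      inner_smul_left]
    ring
  definite U hU := by
    have h := congrArg Complex.re hU
    simp only [Complex.add_re, Complex.re_ofReal_mul, re_inner_self, Complex.zero_re] at h
    have ha := P.a_pos
    have hk := P.γκ_pos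
    have h1 : 0 ≤ ‖U.v‖ ^ 2 := by positivity
    have h2 : 0 ≤ ‖weakDeriv (U.u : L2I)‖ ^ 2 := by positivity
    have h3 : 0 ≤ ‖U.z‖ ^ 2 := by positivity
    have h4 : 0 ≤ P.a * ‖weakDeriv (U.y : L2I)‖ ^ 2 := by positivity
    have h5 : 0 ≤ P.γκ * ‖U.w‖ ^ 2 := by positivity
    have e1 : ‖U.v‖ ^ 2 = 0 := by linarith
    have e2 : ‖weakDeriv (U.u : L2I)‖ ^ 2 = 0 := by linarith
    have e3 : ‖U.z‖ ^ 2 = 0 := by linarith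
    have e4 : P.a * ‖weakDeriv (U.y : L2I)‖ ^ 2 = 0 := by linarith
    have e5 : P.γκ * ‖U.w‖ ^ 2 = 0 := by linarith
    simp only [mul_eq_zero, ha.ne', hk.ne', false_or, pow_eq_zero_iff, ne_eq,
      OfNat.ofNat_ne_zero, not_false_eq_true, norm_eq_zero] at e1 e2 e3 e4 e5
    refine Energy.ext (Subtype.ext ?_) e1 (Subtype.ext ?_) e3 e5
    · exact H1L_eq_zero U.u.2 e2
    · exact H1L_eq_zero (H10_le_H1L U.y.2) e4

instance : NormedAddCommGroup (Energy P) :=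
  (core P).toNormedAddCommGroup

instance : InnerProductSpace ℂ (Energy P) :=
  InnerProductSpace.ofCore (core P).toCore

end Energy

/-! ### The operator -/

/-- The function `ξ ↦ -(ξ² + η) ω(ξ) + v(1) μ(ξ)`. -/
def diffusionPart (P : Params) (v : L2I) (w : L2R) (ξ : ℝ) : ℂ :=
  -(((ξ ^ 2 + P.η : ℝ) : ℂ) * w ξ) + pointValue v 1 * (P.μ ξ : ℂ)

theorem diffusionPart_add (P : Params) {v v' : L2I} (hv : v ∈ H1) (hv' : v' ∈ H1) (w w' : L2R) :
    diffusionPart P (v + v') (w + w') =ᵐ[volume]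
      diffusionPart P v w + diffusionPart P v' w' := by
  filter_upwards [Lp.coeFn_add w w'] with ξ hξ
  simp only [diffusionPart, hξ, Pi.add_apply, pointValue_add hv hv' (c := 1) (by simp)]
  ring

theorem diffusionPart_smul (P : Params) {v : L2I} (hv : v ∈ H1) (w : L2R) (c : ℂ) :
    diffusionPart P (c • v) (c • w) =ᵐ[volume] c • diffusionPart P v w := by
  filter_upwards [Lp.coeFn_smul c w] with ξ hξ
  simp only [diffusionPart, hξ, Pi.smul_apply, smul_eq_mul,
    pointValue_smul c hv (c := 1) (by simp)]
  ring

/-- The domain of the operator. The condition `u ∈ H²(0,1)` is expressed as `u, u_x ∈ H¹(0,1)`,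
and similarly for `y`. (The integrability of `μ ω`, listed so that the boundary condition makes
sense, follows from `ω ∈ L²(ℝ)` and `|ξ| ω ∈ L²(ℝ)`.) -/
def domain (P : Params) : Submodule ℂ (Energy P) where
  carrier := {U | weakDeriv U.u ∈ H1 ∧ weakDeriv U.y ∈ H1 ∧ U.v ∈ H1L ∧ U.z ∈ H10 ∧
    MemLp (diffusionPart P U.v U.w) 2 volume ∧
    MemLp (fun ξ : ℝ => ((|ξ| : ℝ) : ℂ) * U.w ξ) 2 volume ∧
    Integrable (fun ξ : ℝ => (P.μ ξ : ℂ) * U.w ξ) volume ∧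
    pointValue (weakDeriv U.u) 1 + (P.γκ : ℂ) * ∫ ξ : ℝ, (P.μ ξ : ℂ) * U.w ξ = 0}
  zero_mem' := by
    have h0 : weakDeriv 0 = 0 := isWeakDeriv_zero.weakDeriv_eq
    have hw : ∀ m : ℝ → ℂ, (fun ξ => m ξ * (0 : L2R) ξ) =ᵐ[volume] 0 := by
      intro m
      filter_upwards [Lp.coeFn_zero ℂ 2 (volume : Measure ℝ)] with ξ hξ
      rw [hξ]
      exact mul_zero _
    have hd : diffusionPart P 0 0 =ᵐ[volume] 0 := by
      filter_upwards [Lp.coeFn_zero ℂ 2 (volume : Measure ℝ)] with ξ hξ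
      rw [diffusionPart, hξ, pointValue_zero (c := 1) (by simp), Pi.zero_apply, zero_mul, add_zero,
        neg_eq_zero]
      exact mul_zero _
    refine ⟨?_, ?_, H1L.zero_mem, H10.zero_mem, ?_, ?_, ?_, ?_⟩
    · simp [h0]
    · simp [h0]
    · exact (memLp_congr_ae hd).2 MemLp.zero
    · exact (memLp_congr_ae (hw _)).2 MemLp.zero
    · exact (integrable_congr (hw _)).2 (integrable_zero _ _ _)
    · have hi : ∫ ξ : ℝ, (P.μ ξ : ℂ) * (0 : L2R) ξ = 0 := integral_eq_zero_of_ae (hw _)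
      have hp : pointValue (weakDeriv 0) 1 = 0 := by rw [h0, pointValue_zero (by simp)]
      change pointValue (weakDeriv 0) 1 + (P.γκ : ℂ) * ∫ ξ : ℝ, (P.μ ξ : ℂ) * (0 : L2R) ξ = 0
      rw [hi, hp, mul_zero, add_zero]
  add_mem' := by
    rintro U V ⟨a1, a2, a3, a4, a5, a6, a7, a8⟩ ⟨b1, b2, b3, b4, b5, b6, b7, b8⟩
    have h1 := weakDeriv_add U.u.2.1 V.u.2.1
    have h2 := weakDeriv_add U.y.2.1 V.y.2.1
    have hw : ∀ m : ℝ → ℂ, (fun ξ => m ξ * (U.w + V.w : L2R) ξ) =ᵐ[volume]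
        (fun ξ => m ξ * U.w ξ) + fun ξ => m ξ * V.w ξ := by
      intro m
      filter_upwards [Lp.coeFn_add U.w V.w] with ξ hξ
      rw [hξ, Pi.add_apply, Pi.add_apply, mul_add]
    refine ⟨?_, ?_, H1L.add_mem a3 b3, H10.add_mem a4 b4, ?_, ?_, ?_, ?_⟩
    · simpa only [Energy.add_u, Submodule.coe_add, h1] using H1.add_mem a1 b1
    · simpa only [Energy.add_y, Submodule.coe_add, h2] using H1.add_mem a2 b2
    · exact (memLp_congr_ae (diffusionPart_add P a3.1 b3.1 U.w V.w)).2 (a5.add b5)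
    · exact (memLp_congr_ae (hw _)).2 (a6.add b6)
    · exact (integrable_congr (hw _)).2 (a7.add b7)
    · have hi : ∫ ξ : ℝ, (P.μ ξ : ℂ) * (U.w + V.w : L2R) ξ =
          (∫ ξ : ℝ, (P.μ ξ : ℂ) * U.w ξ) + ∫ ξ : ℝ, (P.μ ξ : ℂ) * V.w ξ := by
        rw [integral_congr_ae (hw _)]
        exact integral_add a7 b7
      simp only [Energy.add_u, Energy.add_w, Submodule.coe_add, h1]
      rw [hi, pointValue_add a1 b1 (by simp)]
      linear_combination a8 + b8
  smul_mem' := by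
    rintro c U ⟨a1, a2, a3, a4, a5, a6, a7, a8⟩
    have h1 := weakDeriv_smul c U.u.2.1
    have h2 := weakDeriv_smul c U.y.2.1
    have hw : ∀ m : ℝ → ℂ, (fun ξ => m ξ * (c • U.w : L2R) ξ) =ᵐ[volume]
        c • fun ξ => m ξ * U.w ξ := by
      intro m
      filter_upwards [Lp.coeFn_smul c U.w] with ξ hξ
      simp only [hξ, Pi.smul_apply, smul_eq_mul]
      ring
    refine ⟨?_, ?_, H1L.smul_mem c a3, H10.smul_mem c a4, ?_, ?_, ?_, ?_⟩
    · simpa only [Energy.smul_u, Submodule.coe_smul, h1] using H1.smul_mem c a1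
    · simpa only [Energy.smul_y, Submodule.coe_smul, h2] using H1.smul_mem c a2
    · exact (memLp_congr_ae (diffusionPart_smul P a3.1 U.w c)).2 (a5.const_smul c)
    · exact (memLp_congr_ae (hw _)).2 (a6.const_smul c)
    · exact (integrable_congr (hw _)).2 (a7.smul c)
    · have hi : ∫ ξ : ℝ, (P.μ ξ : ℂ) * (c • U.w : L2R) ξ =
          c * ∫ ξ : ℝ, (P.μ ξ : ℂ) * U.w ξ := by
        rw [integral_congr_ae (hw _)]
        exact integral_smul c _
      simp only [Energy.smul_u, Energy.smul_w, Submodule.coe_smul, h1]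
      rw [hi, pointValue_smul c a1 (by simp)]
      linear_combination c * a8

/-- The unbounded operator
`A (u, v, y, z, ω) = (v, u_xx - b z, z, a y_xx + b v, -(ξ² + η) ω + v(1) μ(ξ))`. -/
def waveOp (P : Params) : Energy P →ₗ.[ℂ] Energy P where
  domain := domain P
  toFun :=
    { toFun := fun U =>
        { u := ⟨U.1.v, U.2.2.2.1⟩
          v := weakDeriv (weakDeriv U.1.u) - (P.b : ℂ) • U.1.z
          y := ⟨U.1.z, U.2.2.2.2.1⟩
          z := (P.a : ℂ) • weakDeriv (weakDeriv U.1.y) + (P.b : ℂ) • U.1.v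
          w := MemLp.toLp (diffusionPart P U.1.v U.1.w) U.2.2.2.2.2.1 }
      map_add' := by
        rintro ⟨U, hU⟩ ⟨V, hV⟩
        have h1 := weakDeriv_add U.u.2.1 V.u.2.1
        have h2 := weakDeriv_add U.y.2.1 V.y.2.1
        refine Energy.ext rfl ?_ rfl ?_ ?_
        · simp only [Submodule.coe_add, Energy.add_u, Energy.add_v, Energy.add_z, h1,
            weakDeriv_add hU.1 hV.1, smul_add]
          abel
        · simp only [Submodule.coe_add, Energy.add_y, Energy.add_v, Energy.add_z, h2,
            weakDeriv_add hU.2.1 hV.2.1, smul_add]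
          abel
        · exact (MemLp.toLp_congr (add_mem hU hV).2.2.2.2.1 (hU.2.2.2.2.1.add hV.2.2.2.2.1)
            (diffusionPart_add P hU.2.2.1.1 hV.2.2.1.1 U.w V.w)).trans
            (MemLp.toLp_add hU.2.2.2.2.1 hV.2.2.2.2.1)
      map_smul' := by
        rintro c ⟨U, hU⟩
        have h1 := weakDeriv_smul c U.u.2.1
        have h2 := weakDeriv_smul c U.y.2.1
        refine Energy.ext rfl ?_ rfl ?_ ?_
        · simp only [Submodule.coe_smul, Energy.smul_u, Energy.smul_v, Energy.smul_z, h1,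
            weakDeriv_smul c hU.1, smul_sub, RingHom.id_apply, smul_comm c]
        · simp only [Submodule.coe_smul, Energy.smul_y, Energy.smul_v, Energy.smul_z, h2,
            weakDeriv_smul c hU.2.1, smul_add, RingHom.id_apply, smul_comm c]
        · exact (MemLp.toLp_congr (Submodule.smul_mem _ c hU).2.2.2.2.1
            (hU.2.2.2.2.1.const_smul c)
            (diffusionPart_smul P hU.2.2.1.1 U.w c)).trans
            (MemLp.toLp_const_smul c hU.2.2.2.2.1) }

/-! ### Strongly continuous semigroups -/

/-- A strongly continuous semigroup of bounded operators on `X`. -/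
structure C0Semigroup (X : Type*) [NormedAddCommGroup X] [NormedSpace ℂ X] where
  toFun : ℝ≥0 → X →L[ℂ] X
  map_zero : toFun 0 = ContinuousLinearMap.id ℂ X
  map_add : ∀ s t, toFun (s + t) = (toFun s).comp (toFun t)
  continuous_apply : ∀ x, Continuous fun t => toFun t x

namespace C0Semigroup

variable {X : Type*} [NormedAddCommGroup X] [NormedSpace ℂ X]

/-- `A` is the infinitesimal generator of `T`, i.e. `T(t) = e^{tA}`: one has `x ∈ D(A)` and
`A x = y` if and only if `(T(t) x - x) / t → y` as `t → 0⁺`. -/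
def IsGeneratedBy (T : C0Semigroup X) (A : X →ₗ.[ℂ] X) : Prop :=
  ∀ x y : X, (x, y) ∈ A.graph ↔
    Tendsto (fun t : ℝ≥0 => ((t : ℝ) : ℂ)⁻¹ • (T.toFun t x - x)) (𝓝[>] 0) (𝓝 y)

/-- `T` is a semigroup of contractions. -/
def IsContractive (T : C0Semigroup X) : Prop := ∀ t, ‖T.toFun t‖ ≤ 1

/-- Uniform (exponential) stability: `‖T(t)‖ ≤ M e^{-δ t}` for some `M` and some `δ > 0`. -/
def IsExponentiallyStable (T : C0Semigroup X) : Prop :=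
  ∃ M δ : ℝ, 0 < δ ∧ ∀ t : ℝ≥0, ‖T.toFun t‖ ≤ M * Real.exp (-δ * t)

end C0Semigroup

end CoupledWave

end

/-!
The proof has two independent halves.

*Generation.* The operator `waveOp P` is dissipative (`waveOp_isDissipative`): integrating by parts,
the interior terms and the coupling terms cancel in real part, and the boundary term at `x = 1` is
absorbed by the diffusive variable. It is maximal: without the coupling, the resolvent equation
`l U - A U = F` reduces to a Robin problem for `u`, a Dirichlet problem for `y` and a pointwise
equation for `ω`, all solvable explicitly (`exists_decoupled_resolvent`); the coupling is a bounded
skew operator, so a Neumann series restores it for large `l` (`surjective_of_skew_perturbation`).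
The Lumer–Phillips theorem (`IsDissipative.exists_semigroup`), proved here on Hilbert spaces through
Yosida approximations, then provides the contraction semigroup.

*Lack of exponential stability.* Exponential stability would give a bound `‖U‖ ≤ C ‖(i l - A) U‖`
uniform in `l ∈ ℝ` (`C0Semigroup.IsExponentiallyStable.exists_norm_le`). It is violated along the
frequencies `l = √a π N` (`exists_quasimode`): the second wave carries the undamped mode
`sin (N π x)`, and because `a ≠ 1` this frequency is not resonant for the first wave, whose forced
response is a multiple of `sin (N π x) / l²` and vanishes at the damped end `x = 1`. Only the small
flux `u_x(1) = O(1 / N)` has to be balanced by `ω`; since `μ ∉ L²` at infinity, this can be done by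
an `ω` near `|ξ| = √N` so small that the residual tends to zero like `N^{-α/2}`.
-/

namespace CoupledWave

/-! ### Dissipative operators and their resolvents -/

section Semigroups

variable {X : Type*} [NormedAddCommGroup X] [InnerProductSpace ℂ X]

/-- A partially defined operator on a complex Hilbert space is dissipative if
`Re ⟨x, A x⟩ ≤ 0` on its domain. -/
def IsDissipative (A : X →ₗ.[ℂ] X) : Prop :=
  ∀ x : A.domain, (inner ℂ (x : X) (A x)).re ≤ 0

/-- `R` is the bounded inverse of `l - A`, with the bound `1 / l` that dissipativity gives. -/
structure IsResolvent (A : X →ₗ.[ℂ] X) (l : ℝ) (R : X →L[ℂ] X) : Prop where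
  mem : ∀ f, R f ∈ A.domain
  map_eq : ∀ f, A ⟨R f, mem f⟩ = (l : ℂ) • R f - f
  left_inv : ∀ x : A.domain, R ((l : ℂ) • (x : X) - A x) = x
  norm_le : ∀ f, ‖R f‖ ≤ l⁻¹ * ‖f‖

theorem re_inner_self_eq (x : X) : (inner ℂ x x).re = ‖x‖ ^ 2 :=
  inner_self_eq_norm_sq (𝕜 := ℂ) x

theorem re_inner_le_norm_mul_norm (x y : X) : (inner ℂ x y).re ≤ ‖x‖ * ‖y‖ :=
  (Complex.re_le_norm _).trans (norm_inner_le_norm x y)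

theorem re_inner_sub_ofReal_smul (l : ℝ) (x y : X) :
    (inner ℂ x ((l : ℂ) • x - y)).re = l * ‖x‖ ^ 2 - (inner ℂ x y).re := by
  rw [inner_sub_right, inner_smul_right, Complex.sub_re, Complex.re_ofReal_mul, re_inner_self_eq]

theorem IsDissipative.mul_norm_le {A : X →ₗ.[ℂ] X} (hA : IsDissipative A) (l : ℝ)
    (x : A.domain) : l * ‖(x : X)‖ ≤ ‖(l : ℂ) • (x : X) - A x‖ := by
  have h := re_inner_le_norm_mul_norm (x : X) ((l : ℂ) • (x : X) - A x)
  rw [re_inner_sub_ofReal_smul] at h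
  have h1 := hA x
  rcases (norm_nonneg (x : X)).eq_or_lt with h0 | h0
  · rw [← h0, mul_zero]; positivity
  · refine le_of_mul_le_mul_left ?_ h0
    linarith

theorem IsDissipative.exists_isResolvent {A : X →ₗ.[ℂ] X} (hA : IsDissipative A) {l : ℝ}
    (hl : 0 < l) (hs : ∀ f : X, ∃ x : A.domain, (l : ℂ) • (x : X) - A x = f) :
    ∃ R, IsResolvent A l R := by
  let L : A.domain →ₗ[ℂ] X := (l : ℂ) • A.domain.subtype - A.toFun
  have hL : ∀ x : A.domain, L x = (l : ℂ) • (x : X) - A x := fun x => rfl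
  have hbound : ∀ x : A.domain, l * ‖(x : X)‖ ≤ ‖L x‖ := fun x => hA.mul_norm_le l x
  have hinj : Function.Injective L := by
    rw [injective_iff_map_eq_zero]
    intro x hx
    have := hbound x
    rw [hx, norm_zero] at this
    have h0 : ‖(x : X)‖ ≤ 0 := nonpos_of_mul_nonpos_right this hl
    exact Subtype.ext (norm_le_zero_iff.1 h0)
  let e := LinearEquiv.ofBijective L ⟨hinj, fun f => hs f⟩
  have he : ∀ f, L (e.symm f) = f := fun f => e.apply_symm_apply f
  refine ⟨(A.domain.subtype ∘ₗ e.symm.toLinearMap).mkContinuous l⁻¹ fun f => ?_,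
    fun f => (e.symm f).2, fun f => ?_, fun x => ?_, fun f => ?_⟩
  · have := hbound (e.symm f)
    rw [he] at this
    rw [inv_mul_eq_div, le_div_iff₀' hl]
    exact this
  · have := he f
    rw [hL] at this
    change A (e.symm f) = (l : ℂ) • ((e.symm f : A.domain) : X) - f
    exact eq_sub_of_add_eq (sub_eq_iff_eq_add'.1 this).symm
  · change ((e.symm (L x) : A.domain) : X) = x
    exact congrArg _ (e.symm_apply_apply x)
  · refine (ContinuousLinearMap.le_opNorm _ _).trans ?_
    gcongr
    exact LinearMap.mkContinuous_norm_le _ (inv_nonneg.2 hl.le) _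

/-- On a Hilbert space, a dissipative operator for which some `l - A`, `l > 0`, is onto is densely
defined: a vector `(l - A) x` orthogonal to the domain satisfies `l ‖x‖² ≤ 0`. -/
theorem IsDissipative.dense_domain [CompleteSpace X] {A : X →ₗ.[ℂ] X} (hA : IsDissipative A) {l : ℝ}
    (hl : 0 < l) (hs : ∀ f : X, ∃ x : A.domain, (l : ℂ) • (x : X) - A x = f) :
    Dense (A.domain : Set X) := by
  rw [Submodule.dense_iff_topologicalClosure_eq_top, Submodule.topologicalClosure_eq_top_iff,
    Submodule.eq_bot_iff]
  intro f hf
  obtain ⟨x, rfl⟩ := hs f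
  have h := (Submodule.mem_orthogonal _ _).1 hf x x.2
  have h' := congrArg Complex.re h
  rw [re_inner_sub_ofReal_smul, Complex.zero_re] at h'
  have h0 : ‖(x : X)‖ ^ 2 ≤ 0 := by
    have := hA x
    refine nonpos_of_mul_nonpos_right (a := l) ?_ hl
    linarith
  have hx : x = 0 := by
    apply Subtype.ext
    simpa using le_antisymm h0 (sq_nonneg _)
  simp [hx]

/-- If `B` is bounded and skew and `l - (A - B)` is onto for all `l > 0`, then `l - A` is onto for
`l > ‖B‖`, by a Neumann series. -/
theorem surjective_of_skew_perturbation [CompleteSpace X] {A : X →ₗ.[ℂ] X} (hA : IsDissipative A)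
    (B : X →L[ℂ] X) (hB : ∀ x, (inner ℂ x (B x)).re = 0)
    (hs : ∀ l : ℝ, 0 < l → ∀ f : X, ∃ x : A.domain, (l : ℂ) • (x : X) - (A x - B x) = f)
    {l : ℝ} (hl : ‖B‖ < l) (f : X) : ∃ x : A.domain, (l : ℂ) • (x : X) - A x = f := by
  have hl0 : 0 < l := (norm_nonneg _).trans_lt hl
  let A' : X →ₗ.[ℂ] X := ⟨A.domain, A.toFun - B.toLinearMap ∘ₗ A.domain.subtype⟩
  have hA' : ∀ x : A.domain, A' x = A x - B x := fun x => rfl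
  have hd : IsDissipative A' := by
    intro x
    rw [hA' x, inner_sub_right, Complex.sub_re, hB, sub_zero]
    exact hA x
  obtain ⟨R, hR⟩ := hd.exists_isResolvent hl0 (fun f => hs l hl0 f)
  have hn : ‖B * R‖ < 1 := by
    have h1 : ‖R‖ ≤ l⁻¹ := R.opNorm_le_bound (inv_nonneg.2 hl0.le) hR.norm_le
    calc ‖B * R‖ ≤ ‖B‖ * ‖R‖ := norm_mul_le _ _
      _ ≤ ‖B‖ * l⁻¹ := by gcongr
      _ < 1 := by rwa [← div_eq_mul_inv, div_lt_one hl0]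
  let u := Units.oneSub (B * R) hn
  set g : X := (↑u⁻¹ : X →L[ℂ] X) f with hg
  have hug : g - B (R g) = f := by
    have : (↑u : X →L[ℂ] X) * (↑u⁻¹ : X →L[ℂ] X) = 1 := u.mul_inv
    exact DFunLike.congr_fun this f
  refine ⟨⟨R g, hR.mem g⟩, ?_⟩
  have h1 := hR.map_eq g
  have h2 : A' ⟨R g, hR.mem g⟩ = A ⟨R g, hR.mem g⟩ - B (R g) := rfl
  rw [h2] at h1
  rw [← hug]
  have h3 : A ⟨R g, hR.mem g⟩ = (l : ℂ) • R g - g + B (R g) := by rw [← h1]; abel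
  rw [h3]
  change (l : ℂ) • R g - _ = _
  abel

namespace IsResolvent

variable {A : X →ₗ.[ℂ] X} {l m : ℝ} {R S : X →L[ℂ] X}

theorem apply_map (h : IsResolvent A l R) (x : A.domain) : R (A x) = (l : ℂ) • R x - x := by
  have := h.left_inv x
  rw [map_sub, map_smul] at this
  nth_rewrite 2 [← this]
  abel

theorem map_apply (h : IsResolvent A l R) (x : A.domain) :
    A ⟨R x, h.mem x⟩ = R (A x) := by rw [h.map_eq, h.apply_map]

theorem commute (hR : IsResolvent A l R) (hS : IsResolvent A m S) : Commute R S := by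
  refine ContinuousLinearMap.ext fun f => ?_
  have h1 := hR.map_apply ⟨S f, hS.mem f⟩
  have h2 := hS.left_inv ⟨R (S f), hR.mem _⟩
  rw [h1, hS.map_eq, map_sub R, map_smul R, sub_sub_cancel] at h2
  exact h2.symm

end IsResolvent

/-! ### Yosida approximations -/

/-- The Yosida approximation `l A R = l (l R - 1)` of `A`, where `R = (l - A)⁻¹`. -/
noncomputable def yosida (l : ℝ) (R : X →L[ℂ] X) : X →L[ℂ] X := (l : ℂ) • ((l : ℂ) • R - 1)

theorem yosida_apply (l : ℝ) (R : X →L[ℂ] X) (x : X) :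
    yosida l R x = (l : ℂ) • ((l : ℂ) • R x - x) := rfl

namespace IsResolvent

variable {A : X →ₗ.[ℂ] X} {l m : ℝ} {R S : X →L[ℂ] X}

theorem yosida_apply_domain (h : IsResolvent A l R) (x : A.domain) :
    yosida l R x = (l : ℂ) • R (A x) := by
  rw [yosida_apply, h.apply_map]

theorem norm_smul_le (h : IsResolvent A l R) (hl : 0 < l) (x : X) : ‖(l : ℂ) • R x‖ ≤ ‖x‖ := by
  rw [norm_smul, Complex.norm_real, Real.norm_of_nonneg hl.le]
  calc l * ‖R x‖ ≤ l * (l⁻¹ * ‖x‖) := by gcongr; exact h.norm_le x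
    _ = ‖x‖ := by field_simp

theorem re_inner_yosida_nonpos (h : IsResolvent A l R) (hl : 0 < l) (x : X) :
    (inner ℂ x (yosida l R x)).re ≤ 0 := by
  rw [yosida_apply, inner_smul_right, Complex.re_ofReal_mul, inner_sub_right, Complex.sub_re,
    re_inner_self_eq]
  refine mul_nonpos_of_nonneg_of_nonpos hl.le ?_
  have h1 := re_inner_le_norm_mul_norm x ((l : ℂ) • R x)
  have h2 := h.norm_smul_le hl x
  nlinarith [norm_nonneg x]

theorem commute_yosida (hR : IsResolvent A l R) (hS : IsResolvent A m S) :
    Commute (yosida l R) (yosida m S) := by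
  have h := hR.commute hS
  exact ((((h.smul_left _).smul_right _).sub_left (Commute.one_left _)).sub_right
    (Commute.one_right _)).smul_left _ |>.smul_right _

theorem norm_smul_apply_sub_le (h : IsResolvent A l R) (x : A.domain) :
    ‖(l : ℂ) • R x - x‖ ≤ l⁻¹ * ‖A x‖ := by
  rw [← h.apply_map]
  exact h.norm_le _

end IsResolvent

/-- A pointwise limit statement for uniformly bounded operators needs only be checked on a dense
set. -/
theorem tendsto_of_dense_of_contraction {ι : Type*} {F : Filter ι} {V : ι → X →L[ℂ] X}
    {W : X →L[ℂ] X} (hV : ∀ i x, ‖V i x‖ ≤ ‖x‖) (hW : ∀ x, ‖W x‖ ≤ ‖x‖) {D : Set X}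
    (hD : Dense D) (h : ∀ x ∈ D, Tendsto (fun i => V i x) F (𝓝 (W x))) (x : X) :
    Tendsto (fun i => V i x) F (𝓝 (W x)) := by
  rw [Metric.tendsto_nhds]
  intro ε hε
  obtain ⟨w, hw, hxw⟩ := Metric.mem_closure_iff.1 (hD x) (ε / 3) (by positivity)
  rw [dist_eq_norm] at hxw
  filter_upwards [Metric.tendsto_nhds.1 (h w hw) (ε / 3) (by positivity)] with i hi
  rw [dist_eq_norm] at hi ⊢
  have e : V i x - W x = V i (x - w) + (V i w - W w) - W (x - w) := by
    simp only [map_sub]; abel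
  rw [e]
  calc _ ≤ ‖V i (x - w)‖ + ‖V i w - W w‖ + ‖W (x - w)‖ :=
        (norm_sub_le _ _).trans (by gcongr; exact norm_add_le _ _)
    _ < ε := by linarith [hV i (x - w), hW (x - w)]

theorem tendsto_yosida {A : X →ₗ.[ℂ] X} (hD : Dense (A.domain : Set X)) {l : ℕ → ℝ}
    (hl : ∀ n, 0 < l n) (hlim : Tendsto l atTop atTop) {R : ℕ → X →L[ℂ] X}
    (hR : ∀ n, IsResolvent A (l n) (R n)) (x : A.domain) :
    Tendsto (fun n => yosida (l n) (R n) x) atTop (𝓝 (A x)) := by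
  simp only [fun n => (hR n).yosida_apply_domain x]
  refine tendsto_of_dense_of_contraction (V := fun n => (l n : ℂ) • R n)
    (W := ContinuousLinearMap.id ℂ X) (fun n y => (hR n).norm_smul_le (hl n) y) (fun y => le_rfl)
    hD (fun y hy => ?_) (A x)
  rw [tendsto_iff_norm_sub_tendsto_zero]
  refine squeeze_zero (fun n => norm_nonneg _)
    (fun n => (hR n).norm_smul_apply_sub_le ⟨y, hy⟩) ?_
  simpa using (tendsto_inv_atTop_zero.comp hlim).mul_const ‖A ⟨y, hy⟩‖

/-! ### Semigroups generated by bounded dissipative operators -/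

section Exp

open NormedSpace

theorem hasDerivAt_clm_apply {G : ℝ → X →L[ℂ] X} {G' : X →L[ℂ] X} {t : ℝ}
    (h : HasDerivAt G G' t) (x : X) : HasDerivAt (fun s => G s x) (G' x) t :=
  ((ContinuousLinearMap.apply ℂ X x).restrictScalars ℝ).hasFDerivAt.comp_hasDerivAt t h

variable [CompleteSpace X]

theorem hasDerivAt_exp_smul_apply (B : X →L[ℂ] X) (x : X) (t : ℝ) :
    HasDerivAt (fun s : ℝ => exp (s • B) x) (B (exp (t • B) x)) t :=
  hasDerivAt_clm_apply (hasDerivAt_exp_smul_const' B t) x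

theorem norm_exp_smul_apply_le {B : X →L[ℂ] X} (hB : ∀ x, (inner ℂ x (B x)).re ≤ 0) {t : ℝ}
    (ht : 0 ≤ t) (x : X) : ‖exp (t • B) x‖ ≤ ‖x‖ := by
  let : InnerProductSpace ℝ X := InnerProductSpace.rclikeToReal ℂ X
  have hd : ∀ s : ℝ, HasDerivAt (fun s : ℝ => ‖exp (s • B) x‖ ^ 2)
      (2 * inner ℝ (exp (s • B) x) (B (exp (s • B) x))) s :=
    fun s => (hasDerivAt_exp_smul_apply B x s).norm_sq
  have ha : Antitone (fun s : ℝ => ‖exp (s • B) x‖ ^ 2) := by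
    refine antitone_of_deriv_nonpos (fun s => (hd s).differentiableAt) fun s => ?_
    rw [(hd s).deriv]
    have : inner ℝ (exp (s • B) x) (B (exp (s • B) x)) ≤ 0 := hB _
    linarith
  have := ha ht
  simp only [zero_smul, exp_zero] at this
  exact le_of_sq_le_sq this (norm_nonneg _)

theorem commute_exp_smul_apply {B C : X →L[ℂ] X} (h : Commute B C) (t : ℝ) (x : X) :
    B (exp (t • C) x) = exp (t • C) (B x) :=
  DFunLike.congr_fun ((h.smul_right t).exp_right).eq x

/-- Interpolating between the two semigroups by `s ↦ e^{(t-s)C} e^{sB} x`. -/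
theorem norm_exp_smul_sub_le {B C : X →L[ℂ] X} (hB : ∀ x, (inner ℂ x (B x)).re ≤ 0)
    (hC : ∀ x, (inner ℂ x (C x)).re ≤ 0) (hBC : Commute B C) {t : ℝ} (ht : 0 ≤ t) (x : X) :
    ‖exp (t • B) x - exp (t • C) x‖ ≤ t * ‖B x - C x‖ := by
  have hd : ∀ s : ℝ, HasDerivAt (fun s : ℝ => exp ((t - s) • C) (exp (s • B) x))
      (exp ((t - s) • C) (exp (s • B) (B x - C x))) s := by
    intro s
    have h1 : HasDerivAt (fun s : ℝ => exp ((t - s) • C)) ((-1 : ℝ) • (exp ((t - s) • C) * C)) s :=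
      (hasDerivAt_exp_smul_const C (t - s)).scomp s ((hasDerivAt_id s).const_sub t)
    refine (hasDerivAt_clm_apply (h1.mul (hasDerivAt_exp_smul_const B s)) x).congr_deriv ?_
    have e : C (exp (s • B) x) = exp (s • B) (C x) := commute_exp_smul_apply hBC.symm s x
    change (-1 : ℝ) • exp ((t - s) • C) (C (exp (s • B) x)) +
      exp ((t - s) • C) (exp (s • B) (B x)) = _
    rw [e, neg_one_smul, map_sub, map_sub]
    abel
  have := norm_image_sub_le_of_norm_deriv_le_segment' (a := 0) (b := t) (C := ‖B x - C x‖)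
    (fun s _ => (hd s).hasDerivWithinAt) (fun s hs =>
      (norm_exp_smul_apply_le hC (by linarith [hs.2]) _).trans
        (norm_exp_smul_apply_le hB hs.1 _)) t (right_mem_Icc.2 ht)
  simpa [mul_comm] using this

theorem norm_exp_smul_sub_exp_smul_le {B : X →L[ℂ] X} (hB : ∀ x, (inner ℂ x (B x)).re ≤ 0)
    {s t : ℝ} (hs : 0 ≤ s) (hst : s ≤ t) (x : X) :
    ‖exp (t • B) x - exp (s • B) x‖ ≤ (t - s) * ‖B x‖ := by
  have := norm_image_sub_le_of_norm_deriv_le_segment' (a := s) (b := t) (C := ‖B x‖)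
    (fun r _ => (hasDerivAt_exp_smul_apply B x r).hasDerivWithinAt) (fun r hr => by
      rw [commute_exp_smul_apply (Commute.refl B)]
      exact norm_exp_smul_apply_le hB (hs.trans hr.1) _) t (right_mem_Icc.2 hst)
  rwa [mul_comm]

/-- A first order expansion that only involves `B x`, `w` and `B w`, so that it passes to the limit
along Yosida approximations. -/
theorem norm_exp_smul_sub_sub_le {B : X →L[ℂ] X} (hB : ∀ x, (inner ℂ x (B x)).re ≤ 0)
    {t : ℝ} (ht : 0 ≤ t) (x w : X) :
    ‖exp (t • B) x - x - t • B x‖ ≤ (2 * ‖B x - w‖ + t * ‖B w‖) * t := by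
  have hd : ∀ s : ℝ, HasDerivAt (fun s : ℝ => exp (s • B) x - x - s • B x)
      (exp (s • B) (B x) - B x) s := by
    intro s
    refine (((hasDerivAt_exp_smul_apply B x s).sub_const x).sub
      ((hasDerivAt_id s).smul_const (B x))).congr_deriv ?_
    rw [commute_exp_smul_apply (Commute.refl B), one_smul]
  have := norm_image_sub_le_of_norm_deriv_le_segment' (a := 0) (b := t)
    (C := 2 * ‖B x - w‖ + t * ‖B w‖)
    (fun r _ => (hd r).hasDerivWithinAt) (fun r hr => by
      have e : exp (r • B) (B x) - B x =
          exp (r • B) (B x - w) + (exp (r • B) w - w) - (B x - w) := by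
        rw [map_sub]; abel
      have h1 := norm_exp_smul_apply_le hB hr.1 (B x - w)
      have h2 := norm_exp_smul_sub_exp_smul_le hB le_rfl hr.1 w
      rw [zero_smul, exp_zero, one_apply_eq_self, sub_zero] at h2
      have h3 : r * ‖B w‖ ≤ t * ‖B w‖ := by have := hr.2.le; gcongr
      rw [e]
      calc _ ≤ ‖exp (r • B) (B x - w)‖ + ‖exp (r • B) w - w‖ + ‖B x - w‖ :=
            (norm_sub_le _ _).trans (by gcongr; exact norm_add_le _ _)
        _ ≤ _ := by linarith) t (right_mem_Icc.2 ht)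
  simpa using this

end Exp

/-! ### The Lumer–Phillips theorem and exponential stability -/

theorem exists_limit_of_contractions [CompleteSpace X] {V : ℕ → X →L[ℂ] X}
    (hV : ∀ n x, ‖V n x‖ ≤ ‖x‖) {D : Set X} (hD : Dense D)
    (h : ∀ x ∈ D, CauchySeq fun n => V n x) :
    ∃ W : X →L[ℂ] X, (∀ x, Tendsto (fun n => V n x) atTop (𝓝 (W x))) ∧ ∀ x, ‖W x‖ ≤ ‖x‖ := by
  have hc : ∀ x, CauchySeq fun n => V n x := by
    intro x
    rw [Metric.cauchySeq_iff]
    intro ε hε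
    obtain ⟨w, hw, hxw⟩ := Metric.mem_closure_iff.1 (hD x) (ε / 3) (by positivity)
    rw [dist_eq_norm] at hxw
    obtain ⟨N, hN⟩ := Metric.cauchySeq_iff.1 (h w hw) (ε / 3) (by positivity)
    refine ⟨N, fun m hm n hn => ?_⟩
    have := hN m hm n hn
    rw [dist_eq_norm] at this ⊢
    have e : V m x - V n x = V m (x - w) + (V m w - V n w) - V n (x - w) := by
      simp only [map_sub]; abel
    rw [e]
    calc _ ≤ ‖V m (x - w)‖ + ‖V m w - V n w‖ + ‖V n (x - w)‖ :=
          (norm_sub_le _ _).trans (by gcongr; exact norm_add_le _ _)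
      _ < ε := by linarith [hV m (x - w), hV n (x - w)]
  choose f hf using fun x => cauchySeq_tendsto_of_complete (hc x)
  refine ⟨(linearMapOfTendsto f (fun n => (V n).toLinearMap) (tendsto_pi_nhds.2 hf)).mkContinuous 1
    fun x => ?_, hf, fun x => ?_⟩
  · rw [one_mul]
    exact le_of_tendsto (hf x).norm (Eventually.of_forall fun n => hV n x)
  · exact le_of_tendsto (hf x).norm (Eventually.of_forall fun n => hV n x)

theorem continuous_of_dense_of_contraction {V : ℝ≥0 → X →L[ℂ] X} (hV : ∀ t x, ‖V t x‖ ≤ ‖x‖)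
    {D : Set X} (hD : Dense D) (h : ∀ x ∈ D, Continuous fun t => V t x) (x : X) :
    Continuous fun t => V t x :=
  continuous_iff_continuousAt.2 fun t => tendsto_of_dense_of_contraction hV (hV t) hD
    (fun y hy => (h y hy).continuousAt) x

/-- The Lumer–Phillips theorem on a Hilbert space (where the density of the domain is automatic). -/
theorem IsDissipative.exists_semigroup [CompleteSpace X] {A : X →ₗ.[ℂ] X} (hA : IsDissipative A)
    {l₀ : ℝ} (hl₀ : 0 ≤ l₀)
    (hs : ∀ l, l₀ < l → ∀ f : X, ∃ x : A.domain, (l : ℂ) • (x : X) - A x = f) :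
    ∃ T : C0Semigroup X, T.IsGeneratedBy A ∧ T.IsContractive := by
  have hD := hA.dense_domain (l := l₀ + 1) (by linarith) (hs _ (by linarith))
  let l : ℕ → ℝ := fun n => l₀ + 1 + n
  have hl : ∀ n, l₀ < l n := fun n => by
    have : (0 : ℝ) ≤ n := n.cast_nonneg
    simp only [l]; linarith
  have hl' : ∀ n, 0 < l n := fun n => hl₀.trans_lt (hl n)
  have hlim : Tendsto l atTop atTop :=
    tendsto_atTop_add_const_left _ _ tendsto_natCast_atTop_atTop
  choose R hR using fun n => hA.exists_isResolvent (hl' n) (hs _ (hl n))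
  let Y : ℕ → X →L[ℂ] X := fun n => yosida (l n) (R n)
  have hY : ∀ n x, (inner ℂ x (Y n x)).re ≤ 0 := fun n => (hR n).re_inner_yosida_nonpos (hl' n)
  have hYlim : ∀ x : A.domain, Tendsto (fun n => Y n x) atTop (𝓝 (A x)) :=
    tendsto_yosida hD hl' hlim hR
  have hcontr : ∀ (t : ℝ≥0) n x, ‖NormedSpace.exp ((t : ℝ) • Y n) x‖ ≤ ‖x‖ :=
    fun t n x => norm_exp_smul_apply_le (hY n) t.2 x
  have hcauchy : ∀ (t : ℝ≥0), ∀ x ∈ (A.domain : Set X),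
      CauchySeq fun n => NormedSpace.exp ((t : ℝ) • Y n) x := by
    intro t x hx
    rw [Metric.cauchySeq_iff]
    intro ε hε
    have ht : (0 : ℝ) < t + 1 := by positivity
    obtain ⟨N, hN⟩ := Metric.cauchySeq_iff.1 (hYlim ⟨x, hx⟩).cauchySeq (ε / (t + 1))
      (by positivity)
    refine ⟨N, fun m hm n hn => ?_⟩
    have h1 := hN m hm n hn
    rw [dist_eq_norm] at h1 ⊢
    calc _ ≤ (t : ℝ) * ‖Y m x - Y n x‖ :=
          norm_exp_smul_sub_le (hY m) (hY n) ((hR m).commute_yosida (hR n)) t.2 x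
      _ ≤ (t + 1) * ‖Y m x - Y n x‖ := by gcongr; linarith
      _ < ε := by rwa [lt_div_iff₀' ht] at h1
  choose V hVlim hV using fun t => exists_limit_of_contractions (hcontr t) hD (hcauchy t)
  -- Both estimates hold for the approximations, uniformly in `n`, and pass to the limit.
  have hlip : ∀ x : A.domain, ∀ s t : ℝ≥0, s ≤ t →
      ‖V t x - V s x‖ ≤ ((t : ℝ) - s) * ‖A x‖ := fun x s t hst =>
    le_of_tendsto_of_tendsto' ((hVlim t x).sub (hVlim s x)).norm ((hYlim x).norm.const_mul _)
      fun n => norm_exp_smul_sub_exp_smul_le (hY n) s.2 hst x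
  have htaylor : ∀ x w : A.domain, ∀ t : ℝ≥0,
      ‖V t x - x - (t : ℝ) • A x‖ ≤ (2 * ‖A x - w‖ + t * ‖A w‖) * t := fun x w t =>
    le_of_tendsto_of_tendsto' (((hVlim t x).sub_const _).sub ((hYlim x).const_smul _)).norm
      (((((hYlim x).sub_const _).norm.const_mul _).add ((hYlim w).norm.const_mul _)).mul_const _)
      fun n => norm_exp_smul_sub_sub_le (hY n) t.2 x w
  have hgen : ∀ x : A.domain, Tendsto (fun t : ℝ≥0 => ((t : ℝ) : ℂ)⁻¹ • (V t x - x)) (𝓝[>] 0)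
      (𝓝 (A x)) := by
    intro x
    rw [Metric.tendsto_nhds]
    intro ε hε
    obtain ⟨w, hw, hxw⟩ := Metric.mem_closure_iff.1 (hD (A x)) (ε / 4) (by positivity)
    rw [dist_eq_norm] at hxw
    have hsmall : ∀ᶠ t : ℝ≥0 in 𝓝[>] 0, (t : ℝ) * ‖A ⟨w, hw⟩‖ < ε / 2 := by
      have : Tendsto (fun t : ℝ≥0 => (t : ℝ) * ‖A ⟨w, hw⟩‖) (𝓝 0) (𝓝 (0 * ‖A ⟨w, hw⟩‖)) :=
        (NNReal.continuous_coe.tendsto 0).mul_const _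
      rw [zero_mul] at this
      exact (this.mono_left nhdsWithin_le_nhds).eventually (gt_mem_nhds (by positivity))
    filter_upwards [hsmall, self_mem_nhdsWithin] with t ht ht0
    have ht0' : (0 : ℝ) < t := ht0
    have h1 := htaylor x ⟨w, hw⟩ t
    have e : ((t : ℝ) : ℂ)⁻¹ • (V t x - x) - A x =
        ((t : ℝ) : ℂ)⁻¹ • (V t x - x - (t : ℝ) • A x) := by
      rw [smul_sub _ _ ((t : ℝ) • A x), ← Complex.coe_smul (t : ℝ) (A x), smul_smul,
        inv_mul_cancel₀ (by exact_mod_cast ht0'.ne'), one_smul]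
    rw [dist_eq_norm, e, norm_smul, norm_inv, Complex.norm_real, Real.norm_of_nonneg ht0'.le,
      inv_mul_lt_iff₀ ht0']
    refine h1.trans_lt ?_
    rw [mul_comm]
    have h2 : 2 * ‖A x - w‖ + t * ‖A ⟨w, hw⟩‖ < ε := by linarith
    gcongr
  let T : C0Semigroup X :=
    { toFun := V
      map_zero := by
        ext x
        refine tendsto_nhds_unique (hVlim 0 x) ?_
        simp
      map_add := by
        intro s t
        ext x
        let : NormedAlgebra ℚ (X →L[ℂ] X) := NormedAlgebra.restrictScalars ℚ ℂ _
        refine tendsto_nhds_unique (hVlim (s + t) x) ?_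
        have h1 : ∀ n, NormedSpace.exp (((s + t : ℝ≥0) : ℝ) • Y n) x =
            NormedSpace.exp ((s : ℝ) • Y n) (NormedSpace.exp ((t : ℝ) • Y n) x - V t x) +
              NormedSpace.exp ((s : ℝ) • Y n) (V t x) := by
          intro n
          rw [NNReal.coe_add, add_smul, NormedSpace.exp_add_of_commute
            (((Commute.refl (Y n)).smul_left _).smul_right _), map_sub, sub_add_cancel]
          rfl
        simp only [h1]
        rw [← zero_add ((V s ∘SL V t) x)]
        refine Tendsto.add ?_ (hVlim s (V t x))
        refine squeeze_zero_norm (fun n => hcontr s n _) ?_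
        exact tendsto_iff_norm_sub_tendsto_zero.1 (hVlim t x)
      continuous_apply := by
        refine continuous_of_dense_of_contraction hV hD fun x hx => ?_
        have : LipschitzWith (‖A ⟨x, hx⟩‖₊) fun t => V t x := by
          refine LipschitzWith.of_dist_le_mul fun t s => ?_
          rw [dist_eq_norm, NNReal.dist_eq, coe_nnnorm, mul_comm]
          rcases le_total s t with hst | hst
          · rw [abs_of_nonneg (sub_nonneg.2 (by exact_mod_cast hst))]
            exact hlip ⟨x, hx⟩ s t hst
          · rw [abs_sub_comm, norm_sub_rev, abs_of_nonneg (sub_nonneg.2 (by exact_mod_cast hst))]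
            exact hlip ⟨x, hx⟩ t s hst
        exact this.continuous }
  refine ⟨T, fun x y => ⟨fun h => ?_, fun h => ?_⟩, fun t => ?_⟩
  · obtain ⟨x', rfl, rfl⟩ := (LinearPMap.mem_graph_iff A).1 h
    exact hgen x'
  · -- The generator of `T` extends `A` and is dissipative, while `l - A` is already onto.
    obtain ⟨z, hz⟩ := hs (l 0) (hl 0) ((l 0 : ℂ) • x - y)
    set d : X := x - z with hd
    have h1 : Tendsto (fun t : ℝ≥0 => ((t : ℝ) : ℂ)⁻¹ • (V t d - d)) (𝓝[>] 0) (𝓝 (y - A z)) := by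
      refine (h.sub (hgen z)).congr fun t => ?_
      change ((t : ℝ) : ℂ)⁻¹ • (V t x - x) - _ = _
      rw [← smul_sub, hd, map_sub]
      congr 1; abel
    have h2 : y - A z = (l 0 : ℂ) • d := by
      have : A z = (l 0 : ℂ) • (z : X) - ((l 0 : ℂ) • x - y) := by rw [← hz]; abel
      rw [this, hd, smul_sub]; abel
    rw [h2] at h1
    have h3 : (inner ℂ d ((l 0 : ℂ) • d)).re ≤ 0 := by
      refine le_of_tendsto ((Complex.continuous_re.tendsto _).comp (tendsto_const_nhds.inner h1))
        (Eventually.of_forall fun t => ?_)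
      simp only [Function.comp_apply]
      rw [← Complex.ofReal_inv, inner_smul_right, Complex.re_ofReal_mul, inner_sub_right,
        Complex.sub_re, re_inner_self_eq]
      refine mul_nonpos_of_nonneg_of_nonpos (by positivity) ?_
      have h4 := re_inner_le_norm_mul_norm d (V t d)
      have h5 := hV t d
      nlinarith [norm_nonneg d]
    rw [inner_smul_right, Complex.re_ofReal_mul, re_inner_self_eq] at h3
    have h4 : ‖d‖ ^ 2 ≤ 0 := nonpos_of_mul_nonpos_right h3 (hl' 0)
    have hd0 : d = 0 := by simpa using le_antisymm h4 (sq_nonneg _)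
    rw [hd0, smul_zero] at h2
    rw [LinearPMap.mem_graph_iff]
    exact ⟨z, (sub_eq_zero.1 hd0).symm, (sub_eq_zero.1 h2).symm⟩
  · exact (V t).opNorm_le_bound zero_le_one fun x => by simpa using hV t x

/-- If the semigroup generated by `A` is exponentially stable, then `i l - A` is bounded below
uniformly in `l ∈ ℝ`. -/
theorem C0Semigroup.IsExponentiallyStable.exists_norm_le {T : C0Semigroup X} {A : X →ₗ.[ℂ] X}
    (hT : T.IsGeneratedBy A) (h : T.IsExponentiallyStable) :
    ∃ C : ℝ, ∀ (l : ℝ) (x : A.domain),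
      ‖(x : X)‖ ≤ C * ‖(Complex.I * l) • (x : X) - A x‖ := by
  obtain ⟨M, δ, hδ, hM⟩ := h
  have hM0 : 0 ≤ M := by
    have := (norm_nonneg _).trans (hM 0)
    simpa using this
  obtain ⟨t₀, ht₀, ht₀'⟩ : ∃ t₀ : ℝ≥0, M * Real.exp (-δ * t₀) ≤ 1 / 2 ∧ 0 ≤ t₀ := by
    have h1 : Tendsto (fun t : ℝ≥0 => M * Real.exp (-δ * t)) atTop (𝓝 (M * 0)) := by
      refine (Real.tendsto_exp_atBot.comp ?_).const_mul M
      exact (NNReal.tendsto_coe_atTop.2 tendsto_id).const_mul_atTop_of_neg (by linarith)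
    rw [mul_zero] at h1
    obtain ⟨t, ht⟩ := (h1.eventually (ge_mem_nhds (by norm_num : (0 : ℝ) < 1 / 2))).exists
    exact ⟨t, ht, zero_le⟩
  have hbound : ∀ t : ℝ≥0, ‖T.toFun t‖ ≤ M := fun t => (hM t).trans <| by
    have : Real.exp (-δ * t) ≤ 1 := Real.exp_le_one_iff.2 (by nlinarith [t.2])
    nlinarith
  refine ⟨2 * M * t₀, fun l x => ?_⟩
  set F : X := (Complex.I * l) • (x : X) - A x with hF
  -- The orbit `s ↦ e^{-ils} T(s) x` has right derivative `-e^{-ils} T(s) F`, so it moves by at most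
  -- `t M ‖F‖` up to time `t`, while at `t₀` its norm has at least halved.
  set e : ℝ → ℂ := fun s => Complex.exp (-(Complex.I * l) * s) with he
  have hen : ∀ s, ‖e s‖ = 1 := by
    intro s
    rw [he, Complex.norm_exp]
    simp
  have hed : ∀ s, HasDerivAt e (-(Complex.I * l) * e s) s := by
    intro s
    have := ((hasDerivAt_id (s : ℂ)).const_mul (-(Complex.I * l))).cexp.comp_ofReal
    refine this.congr_deriv ?_
    simp only [id, he]; ring
  have hc : Continuous fun s : ℝ => T.toFun s.toNNReal x :=
    (T.continuous_apply x).comp continuous_real_toNNReal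
  have hd : ∀ s : ℝ, 0 ≤ s → HasDerivWithinAt (fun s : ℝ => T.toFun s.toNNReal x)
      (T.toFun s.toNNReal (A x)) (Ici s) s := by
    intro s hs
    rw [← hasDerivWithinAt_Ioi_iff_Ici, hasDerivWithinAt_iff_tendsto_slope' (by simp)]
    have h1 := (hT x (A x)).1 ((LinearPMap.mem_graph_iff A).2 ⟨x, rfl, rfl⟩)
    have h2 := ((T.toFun s.toNNReal).continuous.tendsto _).comp h1
    have h3 : Tendsto (fun r : ℝ => (r - s).toNNReal) (𝓝[>] s) (𝓝[>] 0) := by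
      refine tendsto_nhdsWithin_iff.2 ⟨?_, ?_⟩
      · have : Continuous fun r : ℝ => (r - s).toNNReal := by fun_prop
        simpa using (this.tendsto s).mono_left nhdsWithin_le_nhds
      · filter_upwards [self_mem_nhdsWithin] with r hr
        exact Real.toNNReal_pos.2 (sub_pos.2 hr)
    refine (h2.comp h3).congr' ?_
    filter_upwards [self_mem_nhdsWithin] with r hr
    have hr' : 0 < r - s := sub_pos.2 hr
    have h4 : T.toFun r.toNNReal x = T.toFun s.toNNReal (T.toFun (r - s).toNNReal x) := by
      have := T.map_add s.toNNReal (r - s).toNNReal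
      rw [← Real.toNNReal_add hs hr'.le, add_sub_cancel] at this
      exact DFunLike.congr_fun this _
    simp only [Function.comp_apply, slope, vsub_eq_sub]
    rw [Real.coe_toNNReal _ hr'.le, map_smul, map_sub, h4, ← Complex.ofReal_inv, Complex.coe_smul]
  have hg : ∀ s : ℝ, 0 ≤ s → HasDerivWithinAt (fun s : ℝ => e s • T.toFun s.toNNReal x)
      (-(e s • T.toFun s.toNNReal F)) (Ici s) s := by
    intro s hs
    refine ((hed s).hasDerivWithinAt.smul (hd s hs)).congr_deriv ?_
    rw [hF, map_sub, map_smul, smul_sub, smul_smul, neg_mul, neg_smul, mul_comm (e s)]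
    abel
  have hcont : Continuous e := continuous_iff_continuousAt.2 fun s => (hed s).continuousAt
  have := norm_image_sub_le_of_norm_deriv_right_le_segment (a := 0) (b := t₀) (C := M * ‖F‖)
    (f := fun s : ℝ => e s • T.toFun s.toNNReal x)
    (hcont.smul hc).continuousOn (fun s hs => hg s hs.1) (fun s hs => by
      rw [norm_neg, norm_smul, hen, one_mul]
      exact (T.toFun s.toNNReal).le_of_opNorm_le (hbound _) _) t₀ (right_mem_Icc.2 t₀.2)
  have h0 : e 0 • T.toFun (0 : ℝ).toNNReal x = (x : X) := by
    simp [he, T.map_zero]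
  rw [h0, Real.toNNReal_coe, sub_zero] at this
  have h5 : ‖e t₀ • T.toFun t₀ x‖ ≤ 1 / 2 * ‖(x : X)‖ := by
    rw [norm_smul, hen, one_mul]
    exact (T.toFun t₀).le_of_opNorm_le ((hM t₀).trans ht₀) _
  have h6 : ‖(x : X)‖ - ‖e t₀ • T.toFun t₀ x‖ ≤ ‖e t₀ • T.toFun t₀ x - x‖ := by
    rw [norm_sub_rev]; exact norm_sub_norm_le _ _
  linarith

end Semigroups

/-! ### Constructing elements of `H¹(0,1)` -/

theorem memLp_of_continuousOn {f : ℝ → ℂ} (hf : ContinuousOn f (Icc 0 1)) :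
    MemLp f 2 (volume.restrict (Ioo (0 : ℝ) 1)) := by
  obtain ⟨C, hC⟩ := (isCompact_Icc (a := (0 : ℝ)) (b := 1)).exists_bound_of_continuousOn hf
  refine MemLp.of_bound
    ((hf.mono Ioo_subset_Icc_self).aestronglyMeasurable measurableSet_Ioo) C ?_
  filter_upwards [ae_restrict_mem measurableSet_Ioo] with x hx
  exact hC x (Ioo_subset_Icc_self hx)

theorem exists_isContRep {f : ℝ → ℂ} (hf : ContinuousOn f (Icc 0 1)) : ∃ u, IsContRep u f :=
  ⟨(memLp_of_continuousOn hf).toLp f, hf, (MemLp.coeFn_toLp _).symm⟩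

theorem integral_deriv_test_eq_zero {φ : ℝ → ℝ} (h1 : ContDiff ℝ ∞ φ)
    (h3 : tsupport φ ⊆ Ioo 0 1) (c : ℂ) : ∫ x in Ioo (0 : ℝ) 1, deriv φ x • c = 0 := by
  have hφ1 : φ 1 = 0 := image_eq_zero_of_notMem_tsupport fun h => by simpa using h3 h
  have hφ0 : φ 0 = 0 := image_eq_zero_of_notMem_tsupport fun h => by simpa using h3 h
  have h := intervalIntegral.integral_deriv_eq_sub (f := φ) (a := 0) (b := 1)
    (fun x _ => (h1.differentiable (by simp)) x)
    ((h1.continuous_deriv (by simp)).intervalIntegrable _ _)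
  rw [hφ1, hφ0, sub_zero, intervalIntegral.integral_of_le zero_le_one,
    integral_Ioc_eq_integral_Ioo] at h
  rw [integral_smul_const, h, zero_smul]

/-- Converse of the fundamental theorem of calculus in `H¹(0,1)`. -/
theorem IsContRep.isWeakDeriv {u p : L2I} {c : ℂ}
    (h : IsContRep u fun x => c + ∫ t in (0 : ℝ)..x, p t) : IsWeakDeriv u p := by
  intro φ h1 h2 h3
  have hd : Continuous (deriv φ) := h1.continuous_deriv (by simp)
  rw [← integral_deriv_smul_primitive h1 h3 p]
  have e : ∫ x in Ioo (0 : ℝ) 1, deriv φ x • u x =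
      ∫ x in Ioo (0 : ℝ) 1, (deriv φ x • c + deriv φ x • ∫ t in (0 : ℝ)..x, p t) := by
    refine integral_congr_ae ?_
    filter_upwards [h.2] with x hx
    rw [← hx, smul_add]
  rw [e, integral_add, integral_deriv_test_eq_zero h1 h3, zero_add]
  · exact ((hd.smul continuous_const).continuousOn.integrableOn_compact isCompact_Icc).mono_set
      Ioo_subset_Icc_self
  · exact ((hd.continuousOn.smul (continuousOn_primitive p)).integrableOn_compact
      isCompact_Icc).mono_set Ioo_subset_Icc_self

theorem exists_primitive (p : L2I) (c : ℂ) :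
    ∃ u : L2I, IsWeakDeriv u p ∧ IsContRep u fun x => c + ∫ t in (0 : ℝ)..x, p t := by
  obtain ⟨u, hu⟩ := exists_isContRep (continuousOn_const (c := c) |>.add (continuousOn_primitive p))
  exact ⟨u, hu.isWeakDeriv, hu⟩

/-- The class in `L²(0,1)` of a continuous function. -/
noncomputable def toL2I (f : ℝ → ℂ) (hf : Continuous f) : L2I :=
  (memLp_of_continuousOn hf.continuousOn).toLp f

theorem isContRep_toL2I {f : ℝ → ℂ} (hf : Continuous f) : IsContRep (toL2I f hf) f :=
  ⟨hf.continuousOn, (MemLp.coeFn_toLp _).symm⟩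

theorem pointValue_toL2I {f : ℝ → ℂ} (hf : Continuous f) {c : ℝ} (hc : c ∈ Icc (0 : ℝ) 1) :
    pointValue (toL2I f hf) c = f c := (isContRep_toL2I hf).pointValue_eq hc

theorem isWeakDeriv_toL2I {f f' : ℝ → ℂ} (hf : Continuous f) (hf' : Continuous f')
    (h : ∀ x, HasDerivAt f (f' x) x) : IsWeakDeriv (toL2I f hf) (toL2I f' hf') := by
  refine IsContRep.isWeakDeriv (c := f 0) ⟨continuousOn_const.add (continuousOn_primitive _), ?_⟩
  have h1 := (isContRep_toL2I hf').2
  filter_upwards [(isContRep_toL2I hf).2, ae_restrict_mem measurableSet_Ioo] with x hx hx'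
  rw [← hx]
  have e : ∫ t in (0 : ℝ)..x, toL2I f' hf' t = ∫ t in (0 : ℝ)..x, f' t := by
    rw [intervalIntegral.integral_of_le hx'.1.le, intervalIntegral.integral_of_le hx'.1.le,
      integral_Ioc_eq_integral_Ioo, integral_Ioc_eq_integral_Ioo]
    exact integral_congr_ae
      (ae_mono (Measure.restrict_mono (Ioo_subset_Ioo_right hx'.2.le) le_rfl) h1.symm)
  rw [e, intervalIntegral.integral_eq_sub_of_hasDerivAt (fun t _ => h t)
    (hf'.intervalIntegrable _ _)]
  ring

theorem smul_toL2I {f g : ℝ → ℂ} (hf : Continuous f) (hg : Continuous g) (c : ℂ)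
    (h : ∀ x, g x = c * f x) : toL2I g hg = c • toL2I f hf := by
  rw [toL2I, toL2I, ← MemLp.toLp_const_smul]
  exact MemLp.toLp_congr _ _ (Eventually.of_forall fun x => h x)

theorem memLp_smul_of_continuous {ψ : ℝ → ℝ} (hψ : Continuous ψ) (u : L2I) :
    MemLp (fun x => ψ x • u x) 2 (volume.restrict (Ioo (0 : ℝ) 1)) := by
  obtain ⟨C, hC⟩ := (isCompact_Icc (a := (0 : ℝ)) (b := 1)).exists_bound_of_continuousOn
    hψ.continuousOn
  refine MemLp.of_le_mul (c := C) (Lp.memLp u)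
    (hψ.aestronglyMeasurable.smul (Lp.aestronglyMeasurable u)) ?_
  filter_upwards [ae_restrict_mem measurableSet_Ioo] with x hx
  rw [norm_smul]
  gcongr
  exact hC x (Ioo_subset_Icc_self hx)

/-! ### Explicit solutions of boundary value problems -/

/-- The equation `w' = c w + g` with `w(0) = 0` is solved by `w(x) = e^{cx} ∫₀ˣ e^{-ct} g(t) dt`. -/
theorem exists_weakDeriv_eq_smul_add (c : ℝ) (g : L2I) :
    ∃ w ∈ H1L, weakDeriv w = (c : ℂ) • w + g := by
  have hE : ContDiff ℝ ∞ fun x : ℝ => Real.exp (c * x) :=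
    Real.contDiff_exp.comp (contDiff_const.mul contDiff_id)
  have hE' : Continuous fun x : ℝ => Real.exp (-(c * x)) := by fun_prop
  have hq' := (memLp_smul_of_continuous hE' g).coeFn_toLp
  set q : L2I := (memLp_smul_of_continuous hE' g).toLp _ with hq
  obtain ⟨w, hw⟩ := exists_isContRep (f := fun x => Real.exp (c * x) • ∫ t in (0 : ℝ)..x, q t)
    (hE.continuous.continuousOn.smul (continuousOn_primitive q))
  have hwd : IsWeakDeriv w ((c : ℂ) • w + g) := by
    intro φ h1 h2 h3
    set χ : ℝ → ℝ := fun x => φ x * Real.exp (c * x) with hχ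
    have hχ1 : ContDiff ℝ ∞ χ := h1.mul hE
    have hχ3 : tsupport χ ⊆ Ioo 0 1 := (tsupport_mul_subset_left).trans h3
    have hχd : ∀ x, deriv χ x = deriv φ x * Real.exp (c * x) + c * χ x := by
      intro x
      have hd1 : HasDerivAt φ (deriv φ x) x := (h1.differentiable (by simp) x).hasDerivAt
      have hd2 : HasDerivAt (fun x => Real.exp (c * x)) (Real.exp (c * x) * (c * 1)) x :=
        ((hasDerivAt_id x).const_mul c).exp
      refine (hd1.mul hd2).deriv.trans ?_
      rw [hχ]
      ring
    have key := integral_deriv_smul_primitive hχ1 hχ3 q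
    have e1 : ∫ x in Ioo (0 : ℝ) 1, χ x • q x = ∫ x in Ioo (0 : ℝ) 1, φ x • g x := by
      refine integral_congr_ae ?_
      filter_upwards [hq'] with x hx
      rw [hx, smul_smul, hχ]
      simp only
      rw [mul_assoc, ← Real.exp_add, add_neg_cancel, Real.exp_zero, mul_one]
    have e2 : ∫ x in Ioo (0 : ℝ) 1, deriv χ x • ∫ t in (0 : ℝ)..x, q t =
        (∫ x in Ioo (0 : ℝ) 1, deriv φ x • w x) +
          ∫ x in Ioo (0 : ℝ) 1, φ x • ((c : ℂ) • w : L2I) x := by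
      rw [← integral_add (integrableOn_smul_of_continuous (h1.continuous_deriv (by simp)) w)
        (integrableOn_smul_of_continuous h1.continuous _)]
      refine integral_congr_ae ?_
      filter_upwards [hw.2, Lp.coeFn_smul (c : ℂ) w] with x hx hx'
      rw [hx', Pi.smul_apply, ← hx, hχd, hχ]
      simp only [Complex.real_smul, smul_eq_mul]
      push_cast
      ring
    rw [integral_smul_add h1.continuous]
    rw [e1, e2] at key
    rw [neg_add, ← key]
    ring
  have hw0 : pointValue w 0 = 0 := by rw [hw.pointValue_eq (by simp)]; simp
  exact ⟨w, ⟨⟨_, hwd⟩, hw0⟩, hwd.weakDeriv_eq⟩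

/-- The equation `u'' = k² u - g` is solved by factoring `∂² - k² = (∂ + k)(∂ - k)`. -/
theorem exists_weakDeriv_weakDeriv_eq (k : ℝ) (g : L2I) :
    ∃ u ∈ H1L, weakDeriv u ∈ H1 ∧ weakDeriv (weakDeriv u) = ((k ^ 2 : ℝ) : ℂ) • u - g := by
  obtain ⟨w, hw, hw'⟩ := exists_weakDeriv_eq_smul_add (-k) (-g)
  obtain ⟨u, hu, hu'⟩ := exists_weakDeriv_eq_smul_add k w
  have hku : (k : ℂ) • u ∈ H1 := H1.smul_mem _ hu.1
  refine ⟨u, hu, ?_, ?_⟩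
  · rw [hu']; exact H1.add_mem hku hw.1
  · rw [hu', weakDeriv_add hku hw.1, weakDeriv_smul _ hu.1, hu', hw', smul_add, smul_smul]
    push_cast
    rw [sq, neg_smul]
    abel

/-- The function `sinh (k x)` as an element of `H¹_L(0,1)`. -/
theorem exists_sinh (k : ℝ) :
    ∃ s ∈ H1L, weakDeriv s ∈ H1 ∧ weakDeriv (weakDeriv s) = ((k ^ 2 : ℝ) : ℂ) • s ∧
      pointValue s 1 = Real.sinh k ∧ pointValue (weakDeriv s) 1 = (k * Real.cosh k : ℝ) := by
  have hs : Continuous fun x : ℝ => ((Real.sinh (k * x) : ℝ) : ℂ) :=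
    Complex.continuous_ofReal.comp (Real.continuous_sinh.comp (continuous_const.mul continuous_id))
  have hc : Continuous fun x : ℝ => ((k * Real.cosh (k * x) : ℝ) : ℂ) :=
    Complex.continuous_ofReal.comp (continuous_const.mul
      (Real.continuous_cosh.comp (continuous_const.mul continuous_id)))
  have hs' : Continuous fun x : ℝ => ((k ^ 2 : ℝ) : ℂ) * ((Real.sinh (k * x) : ℝ) : ℂ) :=
    continuous_const.mul hs
  have h1 : IsWeakDeriv (toL2I _ hs) (toL2I _ hc) := by
    refine isWeakDeriv_toL2I hs hc fun x => ?_
    have := ((hasDerivAt_id x).const_mul k).sinh.ofReal_comp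
    refine this.congr_deriv ?_
    congr 1; simp only [id]; ring
  have h2 : IsWeakDeriv (toL2I _ hc) (toL2I _ hs') := by
    refine isWeakDeriv_toL2I hc hs' fun x => ?_
    have := (((hasDerivAt_id x).const_mul k).cosh.const_mul k).ofReal_comp
    refine this.congr_deriv ?_
    rw [← Complex.ofReal_mul]
    congr 1; simp only [id]; ring
  have e1 := h1.weakDeriv_eq
  have e2 := h2.weakDeriv_eq
  refine ⟨toL2I _ hs, ⟨⟨_, h1⟩, ?_⟩, e1 ▸ ⟨_, h2⟩, ?_, ?_, ?_⟩
  · rw [pointValue_toL2I hs (by simp)]; simp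
  · rw [e1, e2]; exact smul_toL2I hs hs' _ fun x => rfl
  · rw [pointValue_toL2I hs (by simp), mul_one]
  · rw [e1, pointValue_toL2I hc (by simp), mul_one]

/-- The boundary value problem `u'' = k² u - g`, `u(0) = 0`, `p u'(1) + q u(1) = h`: a solution of
the equation is corrected by a multiple of `sinh (k x)`. -/
theorem exists_boundary_value (k p q : ℝ) (hpq : p * (k * Real.cosh k) + q * Real.sinh k ≠ 0)
    (g : L2I) (h : ℂ) :
    ∃ u ∈ H1L, weakDeriv u ∈ H1 ∧ weakDeriv (weakDeriv u) = ((k ^ 2 : ℝ) : ℂ) • u - g ∧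
      (p : ℂ) * pointValue (weakDeriv u) 1 + (q : ℂ) * pointValue u 1 = h := by
  obtain ⟨u, hu, hu1, hu2⟩ := exists_weakDeriv_weakDeriv_eq k g
  obtain ⟨s, hs, hs1, hs2, hs3, hs4⟩ := exists_sinh k
  set d : ℂ := ((p * (k * Real.cosh k) + q * Real.sinh k : ℝ) : ℂ) with hd
  have hd0 : d ≠ 0 := by rw [hd]; exact_mod_cast hpq
  set t : ℂ := (h - (p * pointValue (weakDeriv u) 1 + q * pointValue u 1)) / d with ht
  have e1 : weakDeriv (u + t • s) = weakDeriv u + t • weakDeriv s := by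
    rw [weakDeriv_add hu.1 (H1.smul_mem _ hs.1), weakDeriv_smul _ hs.1]
  refine ⟨u + t • s, H1L.add_mem hu (H1L.smul_mem _ hs), ?_, ?_, ?_⟩
  · rw [e1]; exact H1.add_mem hu1 (H1.smul_mem _ hs1)
  · rw [e1, weakDeriv_add hu1 (H1.smul_mem _ hs1), weakDeriv_smul _ hs1, hu2, hs2, smul_add,
      smul_comm t]
    abel
  · rw [e1, pointValue_add hu1 (H1.smul_mem _ hs1) (by simp), pointValue_smul _ hs1 (by simp),
      pointValue_add hu.1 (H1.smul_mem _ hs.1) (by simp), pointValue_smul _ hs.1 (by simp),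
      hs3, hs4]
    have : t * d = h - (p * pointValue (weakDeriv u) 1 + q * pointValue u 1) :=
      div_mul_cancel₀ _ hd0
    rw [hd] at this
    push_cast at this ⊢
    linear_combination this

/-! ### Integration by parts in `H¹(0,1)` -/

theorem integral_primitive_mul_primitive {f g : ℝ → ℝ} (hf : IntervalIntegrable f volume 0 1)
    (hg : IntervalIntegrable g volume 0 1) (a b : ℝ) :
    ∫ x in (0 : ℝ)..1, (f x * (b + ∫ t in (0 : ℝ)..x, g t) + (a + ∫ t in (0 : ℝ)..x, f t) * g x) =
      (a + ∫ t in (0 : ℝ)..1, f t) * (b + ∫ t in (0 : ℝ)..1, g t) - a * b := by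
  have hF := hf.absolutelyContinuousOnInterval_intervalIntegral (c := 0) (by simp)
  have hG := hg.absolutelyContinuousOnInterval_intervalIntegral (c := 0) (by simp)
  have hca : ∀ c : ℝ, AbsolutelyContinuousOnInterval (fun _ : ℝ => c) 0 1 := fun c =>
    (contDiffOn_const (n := 1)).absolutelyContinuousOnInterval
  have := ((hca a).add hF).integral_deriv_mul_eq_sub ((hca b).add hG)
  simp only [Pi.add_apply, intervalIntegral.integral_same, add_zero] at this
  rw [← this]
  refine intervalIntegral.integral_congr_ae ?_
  filter_upwards [hf.ae_hasDerivAt_integral, hg.ae_hasDerivAt_integral] with x h1 h2 hx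
  have hx' := uIoc_subset_uIcc hx
  have d1 : HasDerivAt ((fun _ : ℝ => a) + fun y => ∫ t in (0 : ℝ)..y, f t) (f x) x :=
    (h1 hx' 0 (by simp)).const_add a
  have d2 : HasDerivAt ((fun _ : ℝ => b) + fun y => ∫ t in (0 : ℝ)..y, g t) (g x) x :=
    (h2 hx' 0 (by simp)).const_add b
  rw [d1.deriv, d2.deriv]

theorem re_inner_L2I (u v : L2I) :
    (inner ℂ u v).re = ∫ x in Ioo (0 : ℝ) 1, ((u x).re * (v x).re + (u x).im * (v x).im) := by
  rw [L2.inner_def]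
  have h := L2.integrable_inner (𝕜 := ℂ) u v
  have := Complex.reCLM.integral_comp_comm h
  simp only [Complex.reCLM_apply] at this
  rw [← this]
  congr 1
  ext x
  simp [mul_comm]

theorem integrable_inner_re (u v : L2I) :
    IntegrableOn (fun x => (u x).re * (v x).re + (u x).im * (v x).im) (Ioo (0 : ℝ) 1) := by
  have h := Complex.reCLM.integrable_comp (L2.integrable_inner (𝕜 := ℂ) u v)
  refine h.congr (Eventually.of_forall fun x => ?_)
  simp [mul_comm]

theorem L2I.intervalIntegrable (u : L2I) {x : ℝ} (hx : x ∈ Icc (0 : ℝ) 1) :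
    IntervalIntegrable u volume 0 x := by
  rw [intervalIntegrable_iff_integrableOn_Ioo_of_le hx.1]
  exact (L2I.integrableOn u).mono_set (Ioo_subset_Ioo_right hx.2)

/-- The real part of the integration by parts formula, which is all that dissipativity needs and
reduces to real-valued functions. -/
theorem re_inner_weakDeriv_add {u v : L2I} (hu : u ∈ H1) (hv : v ∈ H1) :
    (inner ℂ u (weakDeriv v)).re + (inner ℂ (weakDeriv u) v).re =
      (conj (pointValue u 1) * pointValue v 1).re -
        (conj (pointValue u 0) * pointValue v 0).re := by
  have hu' := H1.isContRep hu
  have hv' := H1.isContRep hv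
  set p := weakDeriv u
  set q := weakDeriv v
  set a := pointValue u 0
  set b := pointValue v 0
  rw [hu'.pointValue_eq (c := 1) (by simp), hv'.pointValue_eq (c := 1) (by simp), re_inner_L2I,
    re_inner_L2I, ← integral_add (integrable_inner_re _ _) (integrable_inner_re _ _)]
  have hL : ∀ (L : ℂ →L[ℝ] ℝ) (r : L2I), IntervalIntegrable (fun t => L (r t)) volume 0 1 :=
    fun L r => by
      have := L2I.intervalIntegrable r (x := 1) (by simp)
      exact ⟨L.integrable_comp this.1, L.integrable_comp this.2⟩
  have hLi : ∀ (L : ℂ →L[ℝ] ℝ) (r : L2I), ∀ x ∈ Icc (0 : ℝ) 1,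
      L (∫ t in (0 : ℝ)..x, r t) = ∫ t in (0 : ℝ)..x, L (r t) := fun L r x hx =>
    (L.intervalIntegral_comp_comm (L2I.intervalIntegrable r hx)).symm
  have r1 := integral_primitive_mul_primitive (hL Complex.reCLM p) (hL Complex.reCLM q) a.re b.re
  have r2 := integral_primitive_mul_primitive (hL Complex.imCLM p) (hL Complex.imCLM q) a.im b.im
  have hint : ∀ L : ℂ →L[ℝ] ℝ, ∀ a b : ℝ, IntervalIntegrable (fun x => L (p x) *
      (b + ∫ t in (0 : ℝ)..x, L (q t)) +
        (a + ∫ t in (0 : ℝ)..x, L (p t)) * L (q x)) volume 0 1 := by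
    intro L a b
    have hc : ∀ r : L2I, ∀ c : ℝ, ContinuousOn (fun x => c + ∫ t in (0 : ℝ)..x, L (r t))
        (uIcc 0 1) := fun r c =>
      continuousOn_const.add (intervalIntegral.continuousOn_primitive_interval'
        (hL L r) (by simp))
    exact ((hL L p).mul_continuousOn (hc q b)).add ((hL L q).continuousOn_mul (hc p a))
  have r3 := congrArg₂ (· + ·) r1 r2
  rw [← intervalIntegral.integral_add (hint _ _ _) (hint _ _ _),
    intervalIntegral.integral_of_le zero_le_one, integral_Ioc_eq_integral_Ioo] at r3
  have h1 : (1 : ℝ) ∈ Icc (0 : ℝ) 1 := by simp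
  rw [← hLi _ p 1 h1, ← hLi _ q 1 h1, ← hLi _ p 1 h1, ← hLi _ q 1 h1] at r3
  refine Eq.trans ?_ (r3.trans ?_)
  · refine integral_congr_ae ?_
    filter_upwards [hu'.2, hv'.2, ae_restrict_mem measurableSet_Ioo] with x hx1 hx2 hx
    have hx' := Ioo_subset_Icc_self hx
    rw [← hLi _ p x hx', ← hLi _ q x hx', ← hLi _ p x hx', ← hLi _ q x hx', ← hx1, ← hx2]
    simp only [Complex.reCLM_apply, Complex.imCLM_apply, Complex.add_re, Complex.add_im]
    ring
  · simp only [Complex.reCLM_apply, Complex.imCLM_apply, Complex.mul_re, Complex.conj_re,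
      Complex.conj_im, Complex.add_re, Complex.add_im]
    ring

/-! ### Completeness of the energy space -/

namespace Energy

variable {P : Params}

theorem inner_eq (U V : Energy P) : inner ℂ U V =
    inner ℂ U.v V.v + inner ℂ (weakDeriv U.u) (weakDeriv V.u) + inner ℂ U.z V.z
      + (P.a : ℂ) * inner ℂ (weakDeriv U.y) (weakDeriv V.y) + (P.γκ : ℂ) * inner ℂ U.w V.w := rfl

theorem re_inner_eq (U V : Energy P) : (inner ℂ U V).re =
    (inner ℂ U.v V.v).re + (inner ℂ (weakDeriv U.u) (weakDeriv V.u)).re + (inner ℂ U.z V.z).re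
      + P.a * (inner ℂ (weakDeriv U.y) (weakDeriv V.y)).re + P.γκ * (inner ℂ U.w V.w).re := by
  rw [inner_eq]
  simp only [Complex.add_re, Complex.re_ofReal_mul]

theorem norm_sq_eq (U : Energy P) : ‖U‖ ^ 2 =
    ‖U.v‖ ^ 2 + ‖weakDeriv (U.u : L2I)‖ ^ 2 + ‖U.z‖ ^ 2 + P.a * ‖weakDeriv (U.y : L2I)‖ ^ 2
      + P.γκ * ‖U.w‖ ^ 2 := by
  rw [← re_inner_self, re_inner_eq]
  simp only [re_inner_self]

/-- The map `(u, v, y, z, ω) ↦ (v, u_x, z, y_x, ω)`. -/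
noncomputable def toProd (P : Params) : Energy P →ₗ[ℂ] L2I × L2I × L2I × L2I × L2R where
  toFun U := (U.v, weakDeriv U.u, U.z, weakDeriv U.y, U.w)
  map_add' U V := by
    have h1 := weakDeriv_add U.u.2.1 V.u.2.1
    have h2 := weakDeriv_add U.y.2.1 V.y.2.1
    simp only [add_u, add_v, add_y, add_z, add_w, Submodule.coe_add, h1, h2, Prod.mk_add_mk]
  map_smul' c U := by
    have h1 := weakDeriv_smul c U.u.2.1
    have h2 := weakDeriv_smul c U.y.2.1
    simp only [smul_u, smul_v, smul_y, smul_z, smul_w, Submodule.coe_smul, h1, h2, Prod.smul_mk,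
      RingHom.id_apply]

theorem norm_toProd_le (U : Energy P) :
    ‖toProd P U‖ ≤ (1 + 1 / √P.a + 1 / √P.γκ) * ‖U‖ := by
  have ha := Real.sqrt_pos.2 P.a_pos
  have hk := Real.sqrt_pos.2 P.γκ_pos
  have hn := norm_sq_eq U
  have e1 : P.a * ‖weakDeriv (U.y : L2I)‖ ^ 2 = (√P.a * ‖weakDeriv (U.y : L2I)‖) ^ 2 := by
    rw [mul_pow, Real.sq_sqrt P.a_pos.le]
  have e2 : P.γκ * ‖U.w‖ ^ 2 = (√P.γκ * ‖U.w‖) ^ 2 := by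
    rw [mul_pow, Real.sq_sqrt P.γκ_pos.le]
  rw [e1, e2] at hn
  have key : ∀ r : ℝ, r ^ 2 ≤ ‖U‖ ^ 2 → r ≤ ‖U‖ := fun r h => le_of_sq_le_sq h (norm_nonneg _)
  have h1 : ‖U.v‖ ≤ ‖U‖ := key _ (by rw [hn]; nlinarith [sq_nonneg (√P.γκ * ‖U.w‖)])
  have h2 : ‖weakDeriv (U.u : L2I)‖ ≤ ‖U‖ := key _ (by
    rw [hn]; nlinarith [sq_nonneg (√P.γκ * ‖U.w‖)])
  have h3 : ‖U.z‖ ≤ ‖U‖ := key _ (by rw [hn]; nlinarith [sq_nonneg (√P.γκ * ‖U.w‖)])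
  have h4 : ‖weakDeriv (U.y : L2I)‖ ≤ 1 / √P.a * ‖U‖ := by
    rw [one_div, inv_mul_eq_div, le_div_iff₀' ha]
    exact key _ (by rw [hn]; nlinarith [sq_nonneg (√P.γκ * ‖U.w‖)])
  have h5 : ‖U.w‖ ≤ 1 / √P.γκ * ‖U‖ := by
    rw [one_div, inv_mul_eq_div, le_div_iff₀' hk]
    exact key _ (by rw [hn]; nlinarith [sq_nonneg (√P.a * ‖weakDeriv (U.y : L2I)‖)])
  have p1 : 0 ≤ 1 / √P.a * ‖U‖ := by positivity
  have p2 : 0 ≤ 1 / √P.γκ * ‖U‖ := by positivity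
  have p3 := norm_nonneg U
  change max ‖U.v‖ (max ‖weakDeriv (U.u : L2I)‖ (max ‖U.z‖ (max ‖weakDeriv (U.y : L2I)‖ ‖U.w‖))) ≤ _
  simp only [max_le_iff]
  refine ⟨?_, ?_, ?_, ?_, ?_⟩ <;> linarith

theorem norm_le_toProd (U : Energy P) : ‖U‖ ≤ √(3 + P.a + P.γκ) * ‖toProd P U‖ := by
  have ha := P.a_pos
  have hk := P.γκ_pos
  refine le_of_sq_le_sq ?_ (by positivity)
  rw [mul_pow, Real.sq_sqrt (by positivity), norm_sq_eq]
  have h1 : ‖U.v‖ ≤ ‖toProd P U‖ := norm_fst_le (toProd P U)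
  have h2 : ‖weakDeriv (U.u : L2I)‖ ≤ ‖toProd P U‖ :=
    (norm_fst_le (toProd P U).2).trans (norm_snd_le _)
  have h3 : ‖U.z‖ ≤ ‖toProd P U‖ :=
    (norm_fst_le (toProd P U).2.2).trans ((norm_snd_le _).trans (norm_snd_le _))
  have h4 : ‖weakDeriv (U.y : L2I)‖ ≤ ‖toProd P U‖ :=
    (norm_fst_le (toProd P U).2.2.2).trans
      ((norm_snd_le _).trans ((norm_snd_le _).trans (norm_snd_le _)))
  have h5 : ‖U.w‖ ≤ ‖toProd P U‖ :=
    (norm_snd_le (toProd P U).2.2.2).trans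
      ((norm_snd_le _).trans ((norm_snd_le _).trans (norm_snd_le _)))
  calc _ ≤ ‖toProd P U‖ ^ 2 + ‖toProd P U‖ ^ 2 + ‖toProd P U‖ ^ 2 + P.a * ‖toProd P U‖ ^ 2
        + P.γκ * ‖toProd P U‖ ^ 2 := by gcongr
    _ = _ := by ring

theorem inner_one_eq_integral (p : L2I) :
    inner ℂ (toL2I (fun _ => 1) continuous_const) p = ∫ t in (0 : ℝ)..1, p t := by
  rw [L2.inner_def, intervalIntegral.integral_of_le zero_le_one, integral_Ioc_eq_integral_Ioo]
  refine integral_congr_ae ?_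
  filter_upwards [(isContRep_toL2I (f := fun _ => 1) continuous_const).2] with x hx
  rw [← hx]
  simp

/-- The derivatives of the elements of `H¹₀(0,1)` are exactly the functions with mean zero, which
makes the range of `toProd` closed. -/
theorem range_toProd (P : Params) : Set.range (toProd P) =
    {q | inner ℂ (toL2I (fun _ => 1) continuous_const) q.2.2.2.1 = 0} := by
  ext q
  simp only [Set.mem_range, mem_ofPred_eq]
  constructor
  · rintro ⟨U, rfl⟩
    change inner ℂ _ (weakDeriv (U.y : L2I)) = 0
    have h := (H1.isContRep U.y.2.1).pointValue_eq (c := 1) (by simp)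
    rw [U.y.2.2.1, U.y.2.2.2, zero_add] at h
    rw [inner_one_eq_integral, ← h]
  · obtain ⟨v, p, z, r, w⟩ := q
    intro h
    change inner ℂ _ r = 0 at h
    rw [inner_one_eq_integral] at h
    obtain ⟨u, hu, hu'⟩ := exists_primitive p 0
    obtain ⟨y, hy, hy'⟩ := exists_primitive r 0
    have u0 : pointValue u 0 = 0 := by rw [hu'.pointValue_eq (by simp)]; simp
    have y0 : pointValue y 0 = 0 := by rw [hy'.pointValue_eq (by simp)]; simp
    have y1 : pointValue y 1 = 0 := by rw [hy'.pointValue_eq (by simp), h, add_zero]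
    refine ⟨⟨⟨u, ⟨p, hu⟩, u0⟩, v, ⟨y, ⟨r, hy⟩, y0, y1⟩, z, w⟩, ?_⟩
    change (v, weakDeriv u, z, weakDeriv y, w) = _
    rw [hu.weakDeriv_eq, hy.weakDeriv_eq]

instance completeSpace : CompleteSpace (Energy P) := by
  have hanti : AntilipschitzWith ⟨√(3 + P.a + P.γκ), Real.sqrt_nonneg _⟩ (toProd P) :=
    AddMonoidHomClass.antilipschitz_of_bound _ fun U => norm_le_toProd U
  have hlip := AddMonoidHomClass.lipschitz_of_bound (toProd P) _ (norm_toProd_le (P := P))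
  refine (hanti.isUniformInducing hlip.uniformContinuous).completeSpace ?_
  rw [range_toProd]
  refine IsClosed.isComplete (isClosed_eq ?_ continuous_const)
  fun_prop

end Energy

/-! ### Dissipativity -/

/-- The dissipation `-(ξ² + η) |ω|²` of the diffusive variable is dropped; what remains balances the
boundary term at `x = 1`. -/
theorem re_inner_diffusion_le {P : Params} {v : L2I} {w : L2R}
    (h5 : MemLp (diffusionPart P v w) 2 volume)
    (h7 : Integrable (fun ξ : ℝ => (P.μ ξ : ℂ) * w ξ) volume) :
    (inner ℂ w (h5.toLp _)).re ≤
      (conj (pointValue v 1) * ∫ ξ : ℝ, (P.μ ξ : ℂ) * w ξ).re := by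
  have hη := P.η_nonneg
  rw [L2.inner_def, ← integral_const_mul]
  have i1 : Integrable (fun ξ => inner ℂ (w ξ) (h5.toLp _ ξ)) :=
    L2.integrable_inner (𝕜 := ℂ) w (h5.toLp _)
  have i2 : Integrable (fun ξ => conj (pointValue v 1) * ((P.μ ξ : ℂ) * w ξ)) := h7.const_mul _
  have e1 := Complex.reCLM.integral_comp_comm i1
  have e2 := Complex.reCLM.integral_comp_comm i2
  simp only [Complex.reCLM_apply] at e1 e2
  rw [← e1, ← e2]
  refine integral_mono_ae (Complex.reCLM.integrable_comp i1) (Complex.reCLM.integrable_comp i2) ?_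
  filter_upwards [h5.coeFn_toLp] with ξ hξ
  simp only [hξ, diffusionPart]
  have : 0 ≤ (ξ ^ 2 + P.η) * ((w ξ).re ^ 2 + (w ξ).im ^ 2) := by positivity
  simp only [RCLike.inner_apply, Complex.mul_re, Complex.mul_im, Complex.add_re, Complex.add_im,
    Complex.neg_re, Complex.neg_im, Complex.ofReal_re, Complex.ofReal_im, Complex.conj_re,
    Complex.conj_im]
  nlinarith

theorem waveOp_isDissipative (P : Params) : IsDissipative (waveOp P) := by
  rintro ⟨U, h⟩
  obtain ⟨h1, h2, h3, h4, h5, h6, h7, h8⟩ := id h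
  have hd := mul_le_mul_of_nonneg_left (re_inner_diffusion_le h5 h7) P.γκ_pos.le
  have ibp1 := re_inner_weakDeriv_add h3.1 h1
  have ibp2 := re_inner_weakDeriv_add h4.1 h2
  rw [h3.2] at ibp1
  rw [h4.2.1, h4.2.2] at ibp2
  have s1 : (inner ℂ (weakDeriv (U.u : L2I)) (weakDeriv U.v)).re =
      (inner ℂ (weakDeriv U.v) (weakDeriv (U.u : L2I))).re := inner_re_symm (𝕜 := ℂ) _ _
  have s2 : (inner ℂ (weakDeriv (U.y : L2I)) (weakDeriv U.z)).re =
      (inner ℂ (weakDeriv U.z) (weakDeriv (U.y : L2I))).re := inner_re_symm (𝕜 := ℂ) _ _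
  have s3 : (inner ℂ U.z U.v).re = (inner ℂ U.v U.z).re := inner_re_symm (𝕜 := ℂ) _ _
  have h8' : pointValue (weakDeriv (U.u : L2I)) 1 =
      -((P.γκ : ℂ) * ∫ ξ : ℝ, (P.μ ξ : ℂ) * U.w ξ) := eq_neg_of_add_eq_zero_left h8
  rw [h8', mul_neg, mul_left_comm, Complex.neg_re, Complex.re_ofReal_mul] at ibp1
  rw [Energy.re_inner_eq]
  change (inner ℂ U.v (weakDeriv (weakDeriv U.u) - (P.b : ℂ) • U.z)).re +
    (inner ℂ (weakDeriv (U.u : L2I)) (weakDeriv U.v)).re +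
    (inner ℂ U.z ((P.a : ℂ) • weakDeriv (weakDeriv U.y) + (P.b : ℂ) • U.v)).re +
    P.a * (inner ℂ (weakDeriv (U.y : L2I)) (weakDeriv U.z)).re +
    P.γκ * (inner ℂ U.w (h5.toLp _)).re ≤ 0
  rw [inner_sub_right, inner_add_right, inner_smul_right, inner_smul_right, inner_smul_right,
    Complex.sub_re, Complex.add_re, Complex.re_ofReal_mul, Complex.re_ofReal_mul,
    Complex.re_ofReal_mul, s1, s2, s3]
  simp only [map_zero, zero_mul, Complex.zero_re, sub_zero] at ibp1 ibp2
  have ibp2' := congrArg (P.a * ·) ibp2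
  simp only [mul_add, mul_zero] at ibp2'
  linarith

/-- The bounded operator `(u, v, y, z, ω) ↦ (0, -b z, 0, b v, 0)` that couples the two wave
equations. -/
noncomputable def coupling (P : Params) : Energy P →L[ℂ] Energy P :=
  LinearMap.mkContinuous
    { toFun := fun U => ⟨0, -((P.b : ℂ) • U.z), 0, (P.b : ℂ) • U.v, 0⟩
      map_add' := fun U V => by
        refine Energy.ext ?_ ?_ ?_ ?_ ?_ <;> simp
        abel
      map_smul' := fun c U => by
        refine Energy.ext ?_ ?_ ?_ ?_ ?_ <;> simp
        all_goals exact smul_comm _ _ _ } |P.b| fun U => by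
      refine le_of_sq_le_sq ?_ (by positivity)
      have ha := P.a_pos
      have hk := P.γκ_pos
      have h0 : weakDeriv 0 = 0 := isWeakDeriv_zero.weakDeriv_eq
      rw [mul_pow, Energy.norm_sq_eq, Energy.norm_sq_eq]
      change ‖-((P.b : ℂ) • U.z)‖ ^ 2 + ‖weakDeriv 0‖ ^ 2 + ‖(P.b : ℂ) • U.v‖ ^ 2 +
        P.a * ‖weakDeriv 0‖ ^ 2 + P.γκ * ‖(0 : L2R)‖ ^ 2 ≤ _
      rw [h0, norm_zero, norm_zero, norm_neg, norm_smul, norm_smul, Complex.norm_real,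
        Real.norm_eq_abs]
      have h1 : 0 ≤ |P.b| ^ 2 * (‖weakDeriv (U.u : L2I)‖ ^ 2 + P.a * ‖weakDeriv (U.y : L2I)‖ ^ 2
        + P.γκ * ‖U.w‖ ^ 2) := by positivity
      nlinarith

theorem coupling_apply (P : Params) (U : Energy P) :
    coupling P U = ⟨0, -((P.b : ℂ) • U.z), 0, (P.b : ℂ) • U.v, 0⟩ := rfl

theorem re_inner_coupling (P : Params) (U : Energy P) : (inner ℂ U (coupling P U)).re = 0 := by
  have h0 : weakDeriv 0 = 0 := isWeakDeriv_zero.weakDeriv_eq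
  have s3 : (inner ℂ U.z U.v).re = (inner ℂ U.v U.z).re := inner_re_symm (𝕜 := ℂ) _ _
  rw [Energy.re_inner_eq, coupling_apply]
  simp only [inner_neg_right, inner_smul_right, Submodule.coe_zero, h0, inner_zero_right,
    Complex.neg_re, Complex.re_ofReal_mul, Complex.zero_re, s3]
  ring

/-! ### Integrability of the diffusive kernel -/

theorem integrable_comp_abs {f : ℝ → ℝ} (hf : IntegrableOn f (Ioi 0)) :
    Integrable fun x => f |x| := by
  have h1 : IntegrableOn (fun x => f |x|) (Ioi 0) :=
    hf.congr_fun (fun x hx => by rw [abs_of_pos hx]) measurableSet_Ioi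
  have h2 : IntegrableOn (fun x => f |x|) (Iic 0) := by
    rw [← Measure.map_neg_eq_self (volume : Measure ℝ)]
    let m : MeasurableEmbedding fun x : ℝ => -x := (Homeomorph.neg ℝ).measurableEmbedding
    rw [m.integrableOn_map_iff]
    simp_rw [Function.comp_def, abs_neg, neg_preimage, neg_Iic, neg_zero]
    exact Iff.mpr integrableOn_Ici_iff_integrableOn_Ioi h1
  have := h2.union h1
  rwa [Iic_union_Ioi, integrableOn_univ] at this

theorem measurable_μ (P : Params) : Measurable P.μ :=
  (measurable_id.abs).pow_const _

theorem μ_sq (P : Params) (ξ : ℝ) : P.μ ξ ^ 2 = |ξ| ^ (2 * P.α - 1) := by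
  rw [Params.μ, ← Real.rpow_natCast, ← Real.rpow_mul (abs_nonneg _)]
  congr 1; push_cast; ring

/-- `μ(ξ)² / (l + ξ² + η)` behaves like `|ξ|^{2α-1}` at `0` and like `|ξ|^{2α-3}` at infinity. -/
theorem integrable_μ_sq_div (P : Params) {l : ℝ} (hl : 0 < l) :
    Integrable fun ξ : ℝ => P.μ ξ ^ 2 / (l + ξ ^ 2 + P.η) := by
  have hη := P.η_nonneg
  have h0 := P.α_pos
  have h1 := P.α_lt_one
  have hm : Measurable fun x : ℝ => x ^ (2 * P.α - 1) / (l + x ^ 2 + P.η) := by fun_prop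
  have key : IntegrableOn (fun x : ℝ => x ^ (2 * P.α - 1) / (l + x ^ 2 + P.η)) (Ioi 0) := by
    rw [← Ioc_union_Ioi_eq_Ioi (zero_le_one (α := ℝ))]
    refine IntegrableOn.union ?_ ?_
    · have h2 : IntegrableOn (fun x : ℝ => x ^ (2 * P.α - 1)) (Ioc 0 1) := by
        rw [integrableOn_Ioc_iff_integrableOn_Ioo,
          intervalIntegral.integrableOn_Ioo_rpow_iff zero_lt_one]
        linarith
      refine (h2.const_mul l⁻¹).mono' hm.aestronglyMeasurable ?_
      filter_upwards [ae_restrict_mem measurableSet_Ioc] with x hx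
      have hx0 : 0 ≤ x ^ (2 * P.α - 1) := Real.rpow_nonneg hx.1.le _
      rw [Real.norm_of_nonneg (by positivity), inv_mul_eq_div]
      gcongr
      nlinarith [sq_nonneg x]
    · refine (integrableOn_Ioi_rpow_of_lt (a := 2 * P.α - 3) (by linarith) zero_lt_one).mono'
        hm.aestronglyMeasurable ?_
      filter_upwards [ae_restrict_mem measurableSet_Ioi] with x hx
      have hx' : (0 : ℝ) < x := zero_lt_one.trans hx
      have hx0 : 0 ≤ x ^ (2 * P.α - 1) := Real.rpow_nonneg hx'.le _
      rw [Real.norm_of_nonneg (by positivity), div_le_iff₀ (by positivity)]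
      have e : x ^ (2 * P.α - 1) = x ^ (2 * P.α - 3) * x ^ 2 := by
        rw [← Real.rpow_natCast, ← Real.rpow_add hx']; congr 1; push_cast; ring
      rw [e]
      gcongr
      linarith
  refine (integrable_comp_abs key).congr (Eventually.of_forall fun ξ => ?_)
  simp only
  rw [μ_sq, sq_abs]

/-- The weighted kernel `ψ μ / (l + ξ² + η)` is square integrable if `ψ² = O(l + ξ² + η)`. -/
theorem memLp_mul_μ_div (P : Params) {l : ℝ} (hl : 0 < l) {ψ : ℝ → ℝ} (hψ : Measurable ψ) {C : ℝ}
    (h : ∀ ξ, ψ ξ ^ 2 ≤ C * (l + ξ ^ 2 + P.η)) :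
    MemLp (fun ξ => ((ψ ξ * (P.μ ξ / (l + ξ ^ 2 + P.η)) : ℝ) : ℂ)) 2 volume := by
  have hη := P.η_nonneg
  have hm : Measurable fun ξ : ℝ => ψ ξ * (P.μ ξ / (l + ξ ^ 2 + P.η)) := by
    have := measurable_μ P
    fun_prop
  suffices MemLp (fun ξ : ℝ => ψ ξ * (P.μ ξ / (l + ξ ^ 2 + P.η))) 2 volume from this.ofReal
  rw [memLp_two_iff_integrable_sq hm.aestronglyMeasurable]
  refine ((integrable_μ_sq_div P hl).const_mul C).mono' (hm.pow_const 2).aestronglyMeasurable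
    (Eventually.of_forall fun ξ => ?_)
  have hρ : 0 < l + ξ ^ 2 + P.η := by positivity
  rw [Real.norm_of_nonneg (sq_nonneg _), mul_pow, div_pow]
  have e : C * (P.μ ξ ^ 2 / (l + ξ ^ 2 + P.η)) =
      C * (l + ξ ^ 2 + P.η) * (P.μ ξ ^ 2 / (l + ξ ^ 2 + P.η) ^ 2) := by
    field_simp
  rw [e]
  gcongr
  exact h ξ

theorem memLp_mul_div (P : Params) {l : ℝ} (hl : 0 < l) {ψ : ℝ → ℝ} (hψ : Measurable ψ) {C : ℝ}
    (h : ∀ ξ, |ψ ξ| ≤ C * (l + ξ ^ 2 + P.η)) (w : L2R) :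
    MemLp (fun ξ => ((ψ ξ / (l + ξ ^ 2 + P.η) : ℝ) : ℂ) * w ξ) 2 volume := by
  have hη := P.η_nonneg
  have hm : Measurable fun ξ : ℝ => ψ ξ / (l + ξ ^ 2 + P.η) := by fun_prop
  refine MemLp.of_le_mul (c := C) (Lp.memLp w)
    ((Complex.measurable_ofReal.comp hm).aestronglyMeasurable.mul (Lp.aestronglyMeasurable w))
    (Eventually.of_forall fun ξ => ?_)
  have hρ : 0 < l + ξ ^ 2 + P.η := by positivity
  rw [norm_mul, Complex.norm_real, norm_div, Real.norm_of_nonneg hρ.le, Real.norm_eq_abs]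
  gcongr
  rw [div_le_iff₀ hρ]
  exact h ξ

/-- The diffusive part of the resolvent equation: for a given boundary value `v(1) = c` it is solved
pointwise, and `∫ μ ω` depends affinely on `c` with a nonnegative slope. -/
theorem exists_diffusion (P : Params) {l : ℝ} (hl : 0 < l) (f : L2R) :
    ∃ m : ℝ, 0 ≤ m ∧ ∃ I : ℂ, ∀ c : ℂ, ∃ w : L2R,
      (fun ξ => -(((ξ ^ 2 + P.η : ℝ) : ℂ) * w ξ) + c * (P.μ ξ : ℂ)) =ᵐ[volume]
        (fun ξ => (l : ℂ) * w ξ - f ξ) ∧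
      MemLp (fun ξ : ℝ => ((|ξ| : ℝ) : ℂ) * w ξ) 2 volume ∧
      Integrable (fun ξ : ℝ => (P.μ ξ : ℂ) * w ξ) volume ∧
      ∫ ξ : ℝ, (P.μ ξ : ℂ) * w ξ = I + c * m := by
  have hη := P.η_nonneg
  have hρ : ∀ ξ : ℝ, 0 < l + ξ ^ 2 + P.η := fun ξ => by positivity
  have hρl : ∀ ξ : ℝ, l ≤ l + ξ ^ 2 + P.η := fun ξ => by nlinarith [sq_nonneg ξ]
  have one_le : ∀ ξ : ℝ, 1 ≤ l⁻¹ * (l + ξ ^ 2 + P.η) := fun ξ => by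
    rw [inv_mul_eq_div, le_div_iff₀ hl, one_mul]; exact hρl ξ
  have A1 := memLp_mul_μ_div P hl (ψ := fun _ => 1) measurable_const (C := l⁻¹)
    (fun ξ => by simpa using one_le ξ)
  have A2 := memLp_mul_μ_div P hl (ψ := fun ξ => |ξ|) measurable_id.abs (C := 1)
    (fun ξ => by rw [sq_abs]; linarith)
  have B1 := memLp_mul_div P hl (ψ := fun _ => 1) measurable_const (C := l⁻¹)
    (fun ξ => by simpa using one_le ξ) f
  have B2 := memLp_mul_div P hl (ψ := fun ξ => |ξ|) measurable_id.abs (C := l⁻¹ + 1)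
    (fun ξ => by
      rw [abs_abs]
      have h1 := one_le ξ
      have h2 : |ξ| ≤ 1 + ξ ^ 2 := by nlinarith [sq_abs ξ, sq_nonneg (|ξ| - 1), abs_nonneg ξ]
      nlinarith) f
  have I1 : Integrable (fun ξ => ((P.μ ξ / (l + ξ ^ 2 + P.η) : ℝ) : ℂ) * f ξ) volume := by
    refine (A1.integrable_mul (Lp.memLp f)).congr (Eventually.of_forall fun ξ => ?_)
    simp
  have I2 : Integrable (fun ξ => ((P.μ ξ ^ 2 / (l + ξ ^ 2 + P.η) : ℝ) : ℂ)) volume :=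
    (integrable_μ_sq_div P hl).ofReal
  refine ⟨∫ ξ : ℝ, P.μ ξ ^ 2 / (l + ξ ^ 2 + P.η),
    integral_nonneg fun ξ => div_nonneg (sq_nonneg _) (hρ ξ).le,
    ∫ ξ, ((P.μ ξ / (l + ξ ^ 2 + P.η) : ℝ) : ℂ) * f ξ, fun c => ?_⟩
  have W := B1.add (A1.const_mul c)
  have hw : ∀ᵐ ξ, W.toLp _ ξ = (f ξ + c * P.μ ξ) / ((l + ξ ^ 2 + P.η : ℝ) : ℂ) := by
    filter_upwards [W.coeFn_toLp] with ξ hξ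
    rw [hξ, Pi.add_apply]
    push_cast
    ring
  have e1 : (fun ξ : ℝ => ((|ξ| : ℝ) : ℂ) * W.toLp _ ξ) =ᵐ[volume]
      (fun ξ => ((|ξ| / (l + ξ ^ 2 + P.η) : ℝ) : ℂ) * f ξ) +
        fun ξ => c * ((|ξ| * (P.μ ξ / (l + ξ ^ 2 + P.η)) : ℝ) : ℂ) := by
    filter_upwards [hw] with ξ hξ
    rw [hξ, Pi.add_apply]
    push_cast
    ring
  have e2 : (fun ξ : ℝ => (P.μ ξ : ℂ) * W.toLp _ ξ) =ᵐ[volume]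
      (fun ξ => ((P.μ ξ / (l + ξ ^ 2 + P.η) : ℝ) : ℂ) * f ξ) +
        fun ξ => c * ((P.μ ξ ^ 2 / (l + ξ ^ 2 + P.η) : ℝ) : ℂ) := by
    filter_upwards [hw] with ξ hξ
    rw [hξ, Pi.add_apply]
    push_cast
    ring
  refine ⟨W.toLp _, ?_, (memLp_congr_ae e1).2 (B2.add (A2.const_mul c)),
    (integrable_congr e2).2 (I1.add (I2.const_mul c)), ?_⟩
  · filter_upwards [hw] with ξ hξ
    have h0 : ((l + ξ ^ 2 + P.η : ℝ) : ℂ) ≠ 0 := by exact_mod_cast (hρ ξ).ne'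
    have h1 : W.toLp _ ξ * ((l + ξ ^ 2 + P.η : ℝ) : ℂ) = f ξ + c * P.μ ξ := by
      rw [hξ, div_mul_cancel₀ _ h0]
    push_cast at h1 ⊢
    linear_combination -h1
  · rw [integral_congr_ae e2]
    refine (integral_add I1 (I2.const_mul c)).trans ?_
    rw [integral_const_mul, integral_complex_ofReal]

/-! ### The resolvent of the decoupled system -/

/-- The operator without coupling is onto after a shift by `-l`. Eliminating `v`, `z` and `ω` leaves
`u'' = l² u - g₁` with a Robin condition at `1` and `y'' = (l² / a) y - g₂` with Dirichlet
conditions. -/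
theorem exists_decoupled_resolvent (P : Params) {l : ℝ} (hl : 0 < l) (F : Energy P) :
    ∃ U : (waveOp P).domain, (l : ℂ) • (U : Energy P) - (waveOp P U - coupling P U) = F := by
  have ha := P.a_pos
  have hk := P.γκ_pos
  obtain ⟨m, hm, I, hI⟩ := exists_diffusion P hl F.w
  have hu : (1 : ℝ) * (l * Real.cosh l) + P.γκ * (l * m) * Real.sinh l ≠ 0 := by
    have h1 := Real.cosh_pos l
    have h2 := Real.sinh_pos_iff.2 hl
    positivity
  obtain ⟨u, u1, u2, u3, u4⟩ := exists_boundary_value l 1 (P.γκ * (l * m)) hu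
    ((l : ℂ) • (F.u : L2I) + F.v) (P.γκ * (m * pointValue (F.u : L2I) 1 - I))
  have hy : (0 : ℝ) * (l / √P.a * Real.cosh (l / √P.a)) + 1 * Real.sinh (l / √P.a) ≠ 0 := by
    have h2 := Real.sinh_pos_iff.2 (div_pos hl (Real.sqrt_pos.2 ha))
    rw [zero_mul, zero_add, one_mul]
    exact h2.ne'
  obtain ⟨y, y1, y2, y3, y4⟩ := exists_boundary_value (l / √P.a) 0 1 hy
    ((P.a : ℂ)⁻¹ • ((l : ℂ) • (F.y : L2I) + F.z)) 0
  have y4' : pointValue y 1 = 0 := by simpa using y4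
  set v : L2I := (l : ℂ) • u - F.u with hv
  set z : L2I := (l : ℂ) • y - F.y with hz
  have hvm : v ∈ H1L := H1L.sub_mem (H1L.smul_mem _ u1) F.u.2
  have hy10 : y ∈ H10 := ⟨y1.1, y1.2, y4'⟩
  have hzm : z ∈ H10 := H10.sub_mem (H10.smul_mem _ hy10) F.y.2
  have hv1 : pointValue v 1 = l * pointValue u 1 - pointValue (F.u : L2I) 1 := by
    rw [hv, sub_eq_add_neg, ← neg_one_smul ℂ, pointValue_add (H1.smul_mem _ u1.1)
      (H1.smul_mem _ F.u.2.1) (by simp), pointValue_smul _ u1.1 (by simp),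
      pointValue_smul _ F.u.2.1 (by simp)]
    ring
  obtain ⟨w, w1, w2, w3, w4⟩ := hI (pointValue v 1)
  have hlw : (fun ξ => (l : ℂ) * w ξ - F.w ξ) =ᵐ[volume] ((l : ℂ) • w - F.w : L2R) := by
    filter_upwards [Lp.coeFn_sub ((l : ℂ) • w) F.w, Lp.coeFn_smul (l : ℂ) w] with ξ h1 h2
    rw [h1, Pi.sub_apply, h2, Pi.smul_apply, smul_eq_mul]
  have hd : diffusionPart P v w =ᵐ[volume] ((l : ℂ) • w - F.w : L2R) := w1.trans hlw
  have hmem : MemLp (diffusionPart P v w) 2 volume := (memLp_congr_ae hd).2 (Lp.memLp _)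
  let U : Energy P := ⟨⟨u, u1⟩, v, ⟨y, hy10⟩, z, w⟩
  have hU : U ∈ (waveOp P).domain := by
    refine ⟨u2, y2, hvm, hzm, hmem, w2, w3, ?_⟩
    change pointValue (weakDeriv u) 1 + (P.γκ : ℂ) * ∫ ξ : ℝ, (P.μ ξ : ℂ) * w ξ = 0
    rw [w4, hv1]
    push_cast at u4
    linear_combination u4
  refine ⟨⟨U, hU⟩, ?_⟩
  have hw : hmem.toLp (diffusionPart P v w) = (l : ℂ) • w - F.w := by
    apply Lp.ext
    exact hmem.coeFn_toLp.trans hd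
  have hyk : (P.a : ℂ) • weakDeriv (weakDeriv y) =
      (l : ℂ) • ((l : ℂ) • y - F.y) - F.z := by
    have ha' : (P.a : ℂ) ≠ 0 := by exact_mod_cast ha.ne'
    rw [y3, smul_sub, smul_smul, smul_inv_smul₀ ha', div_pow, Real.sq_sqrt ha.le, smul_sub,
      smul_smul]
    have : (P.a : ℂ) * ((l ^ 2 / P.a : ℝ) : ℂ) = (l : ℂ) * l := by
      push_cast; field_simp
    rw [this]
    abel
  have huk : weakDeriv (weakDeriv u) = (l : ℂ) • ((l : ℂ) • u - F.u) - F.v := by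
    rw [u3, smul_sub, smul_smul]
    push_cast
    rw [sq]
    abel
  have hsub : ∀ V W : Energy P, V - W = ⟨V.u - W.u, V.v - W.v, V.y - W.y, V.z - W.z, V.w - W.w⟩ :=
    fun V W => rfl
  rw [hsub, hsub, coupling_apply]
  refine Energy.ext ?_ ?_ ?_ ?_ ?_
  · refine Subtype.ext ?_
    change (l : ℂ) • u - (v - 0) = F.u
    rw [hv]; abel
  · change (l : ℂ) • v - (weakDeriv (weakDeriv u) - (P.b : ℂ) • z - -((P.b : ℂ) • z)) = F.v
    rw [huk, ← hv]; abel
  · refine Subtype.ext ?_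
    change (l : ℂ) • y - (z - 0) = F.y
    rw [hz]; abel
  · change (l : ℂ) • z -
      ((P.a : ℂ) • weakDeriv (weakDeriv y) + (P.b : ℂ) • v - (P.b : ℂ) • v) = F.z
    rw [hyk, ← hz]; abel
  · change (l : ℂ) • w - (hmem.toLp (diffusionPart P v w) - 0) = F.w
    rw [hw]; abel

theorem exists_waveOp_semigroup (P : Params) :
    ∃ T : C0Semigroup (Energy P), T.IsGeneratedBy (waveOp P) ∧ T.IsContractive :=
  (waveOp_isDissipative P).exists_semigroup (norm_nonneg (coupling P)) fun _ hl f =>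
    surjective_of_skew_perturbation (waveOp_isDissipative P) (coupling P) (re_inner_coupling P)
      (fun _ hl' F => exists_decoupled_resolvent P hl' F) hl f

/-! ### Quasimodes -/

/-- The function `sin (N π x)` as an element of `H¹₀(0,1)`. -/
theorem exists_sine {N : ℕ} (hN : 0 < N) :
    ∃ s ∈ H10, weakDeriv s ∈ H1 ∧
      weakDeriv (weakDeriv s) = ((-(N * Real.pi) ^ 2 : ℝ) : ℂ) • s ∧
      ‖pointValue (weakDeriv s) 1‖ ≤ N * Real.pi ∧ ‖s‖ ^ 2 = 1 / 2 := by
  set k : ℝ := N * Real.pi with hk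
  have hk0 : 0 < k := by positivity
  have hsr : Continuous fun x : ℝ => Real.sin (k * x) := by fun_prop
  have hcr : Continuous fun x : ℝ => k * Real.cos (k * x) := by fun_prop
  have hs : Continuous fun x : ℝ => ((Real.sin (k * x) : ℝ) : ℂ) :=
    Complex.continuous_ofReal.comp hsr
  have hc : Continuous fun x : ℝ => ((k * Real.cos (k * x) : ℝ) : ℂ) :=
    Complex.continuous_ofReal.comp hcr
  have hs' : Continuous fun x : ℝ => ((-k ^ 2 : ℝ) : ℂ) * ((Real.sin (k * x) : ℝ) : ℂ) :=
    continuous_const.mul hs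
  have h1 : IsWeakDeriv (toL2I _ hs) (toL2I _ hc) := by
    refine isWeakDeriv_toL2I hs hc fun x => ?_
    have := ((hasDerivAt_id x).const_mul k).sin.ofReal_comp
    refine this.congr_deriv ?_
    congr 1; simp only [id]; ring
  have h2 : IsWeakDeriv (toL2I _ hc) (toL2I _ hs') := by
    refine isWeakDeriv_toL2I hc hs' fun x => ?_
    have := (((hasDerivAt_id x).const_mul k).cos.const_mul k).ofReal_comp
    refine this.congr_deriv ?_
    rw [← Complex.ofReal_mul]
    congr 1; simp only [id]; ring
  have e1 := h1.weakDeriv_eq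
  have e2 := h2.weakDeriv_eq
  refine ⟨toL2I _ hs, ⟨⟨_, h1⟩, ?_, ?_⟩, e1 ▸ ⟨_, h2⟩, ?_, ?_, ?_⟩
  · rw [pointValue_toL2I hs (by simp)]; simp
  · rw [pointValue_toL2I hs (by simp), mul_one, hk, Real.sin_nat_mul_pi, Complex.ofReal_zero]
  · rw [e1, e2]; exact smul_toL2I hs hs' _ fun x => rfl
  · rw [e1, pointValue_toL2I hc (by simp), Complex.norm_real, norm_mul, Real.norm_of_nonneg hk0.le]
    exact mul_le_of_le_one_right hk0.le (Real.abs_cos_le_one _)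
  · rw [← re_inner_self_eq, re_inner_L2I]
    have e : ∫ x in Ioo (0 : ℝ) 1, ((toL2I _ hs x).re * (toL2I _ hs x).re +
        (toL2I _ hs x).im * (toL2I _ hs x).im) = ∫ x in Ioo (0 : ℝ) 1, Real.sin (k * x) ^ 2 := by
      refine integral_congr_ae ?_
      filter_upwards [(isContRep_toL2I hs).2] with x hx
      rw [← hx, Complex.ofReal_re, Complex.ofReal_im]
      ring
    rw [e, ← integral_Ioc_eq_integral_Ioo, ← intervalIntegral.integral_of_le zero_le_one,
      intervalIntegral.integral_comp_mul_left (fun x => Real.sin x ^ 2) hk0.ne', integral_sin_sq,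
      mul_zero, mul_one, hk, Real.sin_nat_mul_pi, Real.sin_zero, ← hk, smul_eq_mul]
    field_simp
    ring

/-- Multiplication by a function that is bounded by `C` on a set outside of which `w` vanishes. -/
theorem memLp_mul_of_support {w : L2R} {s : Set ℝ} (hw : ∀ᵐ ξ, ξ ∉ s → w ξ = 0) {ψ : ℝ → ℂ}
    (hψ : Measurable ψ) {C : ℝ} (h : ∀ ξ ∈ s, ‖ψ ξ‖ ≤ C) :
    ∃ hm : MemLp (fun ξ => ψ ξ * w ξ) 2 volume, 0 ≤ C → ‖hm.toLp _‖ ≤ C * ‖w‖ := by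
  have hb : ∀ᵐ ξ, ‖ψ ξ * w ξ‖ ≤ C * ‖w ξ‖ := by
    filter_upwards [hw] with ξ hξ
    rw [norm_mul]
    by_cases hs : ξ ∈ s
    · gcongr
      exact h ξ hs
    · rw [hξ hs, norm_zero, mul_zero, mul_zero]
  have hm : MemLp (fun ξ => ψ ξ * w ξ) 2 volume :=
    (Lp.memLp w).of_le_mul (hψ.aestronglyMeasurable.mul (Lp.aestronglyMeasurable w)) hb
  refine ⟨hm, fun hC => Lp.norm_le_mul_norm_of_ae_le_mul ?_⟩
  filter_upwards [hm.coeFn_toLp, hb] with ξ h1 h2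
  rwa [h1]

/-- Since `μ` is not square integrable at infinity, `∫ μ ω` can be prescribed by functions `ω`
supported near `|ξ| = R` whose norm decays like `R^{-α}`. -/
theorem exists_diffusive_cutoff (P : Params) :
    ∃ K : ℝ, 0 ≤ K ∧ ∀ R : ℝ, 0 < R → ∀ q : ℂ, ∃ w : L2R,
      (∀ᵐ ξ, ξ ∉ Ioc R (2 * R) → w ξ = 0) ∧
      Integrable (fun ξ : ℝ => (P.μ ξ : ℂ) * w ξ) volume ∧
      ∫ ξ : ℝ, (P.μ ξ : ℂ) * w ξ = q ∧ ‖w‖ ≤ K * ‖q‖ * R ^ (-P.α) := by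
  have hα := P.α_pos
  set C : ℝ := (2 ^ (P.α + 1 / 2) - 1) / (P.α + 1 / 2) with hC
  have hC0 : 0 < C := by
    have : (1 : ℝ) < 2 ^ (P.α + 1 / 2) := Real.one_lt_rpow (by norm_num) (by positivity)
    exact div_pos (by linarith) (by positivity)
  refine ⟨C⁻¹, inv_nonneg.2 hC0.le, fun R hR q => ?_⟩
  have hJ : ∫ ξ in Ioc R (2 * R), P.μ ξ = C * R ^ (P.α + 1 / 2) := by
    have e : ∫ ξ in Ioc R (2 * R), P.μ ξ = ∫ ξ in Ioc R (2 * R), ξ ^ (P.α - 1 / 2) := by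
      refine setIntegral_congr_fun measurableSet_Ioc fun ξ hξ => ?_
      rw [Params.μ, abs_of_pos (hR.trans hξ.1)]
      congr 1; ring
    rw [e, ← intervalIntegral.integral_of_le (by linarith), integral_rpow (Or.inl (by linarith)),
      Real.mul_rpow (by norm_num) hR.le, hC]
    have : P.α - 1 / 2 + 1 = P.α + 1 / 2 := by ring
    rw [this]
    ring
  have hRp : 0 < R ^ (P.α + 1 / 2) := Real.rpow_pos_of_pos hR _
  have hJ0 : C * R ^ (P.α + 1 / 2) ≠ 0 := by positivity
  have hfin : volume (Ioc R (2 * R)) ≠ ⊤ := by simp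
  set t : ℂ := q / ((C * R ^ (P.α + 1 / 2) : ℝ) : ℂ) with ht
  set w : L2R := indicatorConstLp 2 (measurableSet_Ioc (a := R) (b := 2 * R)) hfin t with hw
  have hwe : w =ᵐ[volume] (Ioc R (2 * R)).indicator fun _ => t := indicatorConstLp_coeFn
  have hμi : IntegrableOn P.μ (Ioc R (2 * R)) := by
    by_contra h
    rw [integral_undef h] at hJ
    exact hJ0 hJ.symm
  have hμw : (fun ξ : ℝ => (P.μ ξ : ℂ) * w ξ) =ᵐ[volume]
      (Ioc R (2 * R)).indicator fun ξ => (P.μ ξ : ℂ) * t := by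
    filter_upwards [hwe] with ξ hξ
    rw [hξ]
    by_cases h : ξ ∈ Ioc R (2 * R)
    · simp [h]
    · simp [h]
  refine ⟨w, ?_, ?_, ?_, ?_⟩
  · filter_upwards [hwe] with ξ hξ h
    rw [hξ, indicator_of_notMem h]
  · rw [integrable_congr hμw, integrable_indicator_iff measurableSet_Ioc]
    exact hμi.ofReal.mul_const t
  · rw [integral_congr_ae hμw, integral_indicator measurableSet_Ioc, integral_mul_const,
      integral_complex_ofReal, hJ, ht]
    exact mul_div_cancel₀ _ (by exact_mod_cast hJ0)
  · rw [hw, norm_indicatorConstLp (by norm_num) (by norm_num), ht, norm_div, Complex.norm_real,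
      Real.norm_of_nonneg (by positivity)]
    have hv : volume.real (Ioc R (2 * R)) = R := by
      rw [Real.volume_real_Ioc_of_le (by linarith)]; ring
    rw [hv, ENNReal.toReal_ofNat]
    have : R ^ (P.α + 1 / 2) * R ^ (-P.α) = R ^ (1 / 2 : ℝ) := by
      rw [← Real.rpow_add hR]; congr 1; ring
    rw [← this]
    apply le_of_eq
    field_simp

/-- For `a ≠ 1` there are approximate eigenvectors at the frequencies `√a π N` of the second wave
equation. With `s = sin(N π x)` and `l = √a π N` take `y = s / l` and `z = i s`; as `l` is
not a resonance of the first equation, that equation is solved exactly by a multiple `u` of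
`s / l²`, for which `v(1) = 0`. The boundary condition is then met by a function `ω` concentrated
near `|ξ| = √N`. -/
theorem exists_quasimode (P : Params) (ha1 : P.a ≠ 1) :
    ∃ D E : ℝ, ∀ N : ℕ, 0 < N → ∃ (l : ℝ) (U : (waveOp P).domain), 1 / 2 ≤ ‖(U : Energy P)‖ ^ 2 ∧
      ‖(Complex.I * l) • (U : Energy P) - waveOp P U‖ ^ 2 ≤
        D * ((N : ℝ)⁻¹) ^ 2 + E * ((N : ℝ) ^ (-(P.α / 2))) ^ 2 := by
  have ha := P.a_pos
  have hk := P.γκ_pos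
  have hη := P.η_nonneg
  have hsa := Real.sqrt_pos.2 ha
  have hπ := Real.pi_pos
  obtain ⟨K, hK, hcut⟩ := exists_diffusive_cutoff P
  -- `c` solves `c (1 - 1 / a) = i b`, which makes the first wave equation hold exactly.
  set c : ℂ := Complex.I * P.b * P.a / (P.a - 1) with hc
  have hac : (P.a - 1 : ℂ) ≠ 0 := by
    rw [sub_ne_zero]; exact_mod_cast ha1
  have ha0 : (P.a : ℂ) ≠ 0 := by exact_mod_cast ha.ne'
  refine ⟨(|P.b| * ‖c‖ / (√P.a * Real.pi)) ^ 2 * (1 / 2),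
    P.γκ * ((√P.a * Real.pi + (4 + P.η)) * (K * (‖c‖ / (P.γκ * (P.a * Real.pi))))) ^ 2,
    fun N hN => ?_⟩
  have hN0 : (0 : ℝ) < N := by exact_mod_cast hN
  have hN1 : (1 : ℝ) ≤ N := by exact_mod_cast hN
  obtain ⟨s, hs, hs1, hs2, hs3, hs4⟩ := exists_sine hN
  set l : ℝ := √P.a * Real.pi * N with hl
  have hl0 : 0 < l := by positivity
  have hlc : (l : ℂ) ≠ 0 := by exact_mod_cast hl0.ne'
  have hl2 : l ^ 2 = P.a * (N * Real.pi) ^ 2 := by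
    rw [hl, mul_pow, mul_pow, Real.sq_sqrt ha.le]; ring
  have hl2c : (l : ℂ) ^ 2 = P.a * ((N * Real.pi : ℝ) : ℂ) ^ 2 := by exact_mod_cast hl2
  set q : ℂ := -(c / l ^ 2 * pointValue (weakDeriv s) 1) / P.γκ with hq
  have hqn : ‖q‖ ≤ ‖c‖ / (P.γκ * (P.a * Real.pi)) * (N : ℝ)⁻¹ := by
    rw [hq, norm_div, norm_neg, norm_mul, norm_div, norm_pow, Complex.norm_real, Complex.norm_real,
      Real.norm_of_nonneg hl0.le, Real.norm_of_nonneg hk.le, hl2]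
    calc _ ≤ ‖c‖ / (P.a * (N * Real.pi) ^ 2) * (N * Real.pi) / P.γκ := by gcongr
      _ = _ := by field_simp
  -- The value `R = √N` balances `R²` against `l ~ N` in the residual `(i l + ξ² + η) ω`.
  obtain ⟨w, hw, hwi, hwq, hwn⟩ := hcut (√N) (Real.sqrt_pos.2 hN0) q
  have hsm : s ∈ H1L := H10_le_H1L hs
  set u : L2I := (c / l ^ 2) • s with hu
  set v : L2I := (Complex.I * c / l) • s with hv
  set y : L2I := (1 / l : ℂ) • s with hy
  set z : L2I := Complex.I • s with hz
  have hum : u ∈ H1L := H1L.smul_mem _ hsm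
  have hvm : v ∈ H1L := H1L.smul_mem _ hsm
  have hym : y ∈ H10 := H10.smul_mem _ hs
  have hzm : z ∈ H10 := H10.smul_mem _ hs
  have hv1 : pointValue v 1 = 0 := by
    rw [hv, pointValue_smul _ hs.1 (by simp), hs.2.2, mul_zero]
  have hu' : weakDeriv u = (c / l ^ 2) • weakDeriv s := weakDeriv_smul _ hs.1
  have hy' : weakDeriv y = (1 / l : ℂ) • weakDeriv s := weakDeriv_smul _ hs.1
  have hξ : ∀ ξ ∈ Ioc (√(N : ℝ)) (2 * √N), |ξ| ≤ 2 * √N := fun ξ hξ => by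
    rw [abs_of_pos ((Real.sqrt_pos.2 hN0).trans hξ.1)]; exact hξ.2
  obtain ⟨m1, -⟩ := memLp_mul_of_support hw (ψ := fun ξ => ((|ξ| : ℝ) : ℂ)) (C := 2 * √N)
    (Complex.measurable_ofReal.comp measurable_id.abs) (fun ξ h => by
      rw [Complex.norm_real, Real.norm_of_nonneg (abs_nonneg _)]
      exact hξ ξ h)
  have hCN : (0 : ℝ) ≤ 4 * N + P.η := by positivity
  obtain ⟨m2, n2⟩ := memLp_mul_of_support hw (ψ := fun ξ => ((-(ξ ^ 2 + P.η) : ℝ) : ℂ))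
    (C := 4 * N + P.η)
    (Complex.measurable_ofReal.comp (by fun_prop)) (fun ξ h => by
      rw [Complex.norm_real, norm_neg, Real.norm_of_nonneg (by positivity)]
      have h1 := hξ ξ h
      have h2 : ξ ^ 2 ≤ (2 * √N) ^ 2 := sq_le_sq' (by linarith [neg_abs_le ξ]) (by
        linarith [le_abs_self ξ])
      rw [mul_pow, Real.sq_sqrt hN0.le] at h2
      linarith)
  have hdeq : (fun ξ => ((-(ξ ^ 2 + P.η) : ℝ) : ℂ) * w ξ) = diffusionPart P v w := by
    ext ξ
    rw [diffusionPart, hv1]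
    push_cast
    ring
  have m3 : MemLp (diffusionPart P v w) 2 volume := hdeq ▸ m2
  have n3 : ‖m3.toLp _‖ ≤ (4 * N + P.η) * ‖w‖ := by
    refine le_trans (le_of_eq ?_) (n2 hCN)
    congr 1
    exact MemLp.toLp_congr _ _ (Eventually.of_forall fun ξ => (congrFun hdeq ξ).symm)
  let U : Energy P := ⟨⟨u, hum⟩, v, ⟨y, hym⟩, z, w⟩
  have hU : U ∈ (waveOp P).domain := by
    refine ⟨hu' ▸ H1.smul_mem _ hs1, hy' ▸ H1.smul_mem _ hs1, hvm, hzm, m3, m1, hwi, ?_⟩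
    change pointValue (weakDeriv u) 1 + (P.γκ : ℂ) * ∫ ξ : ℝ, (P.μ ξ : ℂ) * w ξ = 0
    rw [hwq, hu', pointValue_smul _ hs1 (by simp), hq]
    have : (P.γκ : ℂ) ≠ 0 := by exact_mod_cast hk.ne'
    field_simp
    ring
  refine ⟨l, ⟨U, hU⟩, ?_, ?_⟩
  · have h1 : ‖z‖ ^ 2 = 1 / 2 := by rw [hz, norm_smul, Complex.norm_I, one_mul, hs4]
    change _ ≤ ‖U‖ ^ 2
    rw [Energy.norm_sq_eq]
    change 1 / 2 ≤ ‖v‖ ^ 2 + ‖weakDeriv u‖ ^ 2 + ‖z‖ ^ 2 + P.a * ‖weakDeriv y‖ ^ 2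
      + P.γκ * ‖w‖ ^ 2
    rw [h1]
    have : 0 ≤ ‖v‖ ^ 2 + ‖weakDeriv u‖ ^ 2 := by positivity
    have : 0 ≤ P.a * ‖weakDeriv y‖ ^ 2 + P.γκ * ‖w‖ ^ 2 := by positivity
    linarith
  · have hsub : ∀ V W : Energy P,
        V - W = ⟨V.u - W.u, V.v - W.v, V.y - W.y, V.z - W.z, V.w - W.w⟩ := fun V W => rfl
    have hF : (Complex.I * l) • U - waveOp P ⟨U, hU⟩ =
        ⟨0, 0, 0, (-(P.b * (Complex.I * c / l))) • s, (Complex.I * l) • w - m3.toLp _⟩ := by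
      rw [hsub]
      refine Energy.ext ?_ ?_ ?_ ?_ rfl
      · refine Subtype.ext ?_
        change (Complex.I * l) • u - v = 0
        rw [hu, hv, smul_smul, ← sub_smul]
        convert zero_smul ℂ s
        field_simp
        ring
      · change (Complex.I * l) • v - (weakDeriv (weakDeriv u) - (P.b : ℂ) • z) = 0
        rw [hu', weakDeriv_smul _ hs1, hs2, hv, hz, smul_smul, smul_smul, smul_smul, ← sub_smul,
          ← sub_smul]
        convert zero_smul ℂ s
        have e1 : Complex.I * l * (Complex.I * c / l) = -c := by
          field_simp
          rw [Complex.I_sq]; ring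
        have e2 : c / (l : ℂ) ^ 2 * ((-(N * Real.pi) ^ 2 : ℝ) : ℂ) = -(c / P.a) := by
          have hNπ : ((N * Real.pi : ℝ) : ℂ) ≠ 0 := by
            exact_mod_cast (by positivity : (N * Real.pi : ℝ) ≠ 0)
          rw [hl2c, Complex.ofReal_neg, Complex.ofReal_pow]
          field_simp
        rw [e1, e2, hc]
        field_simp
        ring
      · refine Subtype.ext ?_
        change (Complex.I * l) • y - z = 0
        rw [hy, hz, smul_smul, ← sub_smul]
        convert zero_smul ℂ s
        field_simp
        ring
      · change (Complex.I * l) • z - ((P.a : ℂ) • weakDeriv (weakDeriv y) + (P.b : ℂ) • v) =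
          (-(P.b * (Complex.I * c / l))) • s
        rw [hy', weakDeriv_smul _ hs1, hs2, hv, hz, smul_smul, smul_smul, smul_smul, smul_smul,
          ← add_smul, ← sub_smul]
        congr 1
        have e1 : Complex.I * l * Complex.I = -l := by
          linear_combination (l : ℂ) * Complex.I_mul_I
        have e2 : (P.a : ℂ) * (1 / l * ((-(N * Real.pi) ^ 2 : ℝ) : ℂ)) = -l := by
          have : ((-(N * Real.pi) ^ 2 : ℝ) : ℂ) = -(l ^ 2 / P.a) := by
            rw [hl2c, Complex.ofReal_neg, Complex.ofReal_pow]
            field_simp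
          rw [this]
          field_simp
        linear_combination e1 - e2
    change ‖(Complex.I * l) • U - waveOp P ⟨U, hU⟩‖ ^ 2 ≤ _
    rw [hF, Energy.norm_sq_eq]
    have h0 : weakDeriv 0 = 0 := isWeakDeriv_zero.weakDeriv_eq
    change ‖(0 : L2I)‖ ^ 2 + ‖weakDeriv 0‖ ^ 2 + ‖(-(P.b * (Complex.I * c / l))) • s‖ ^ 2 +
      P.a * ‖weakDeriv 0‖ ^ 2 + P.γκ * ‖(Complex.I * l) • w - m3.toLp _‖ ^ 2 ≤ _
    have hz1 : ‖(-(P.b * (Complex.I * c / l))) • s‖ ^ 2 =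
        (|P.b| * ‖c‖ / (√P.a * Real.pi)) ^ 2 * (1 / 2) * ((N : ℝ)⁻¹) ^ 2 := by
      rw [norm_smul, mul_pow, hs4, norm_neg, norm_mul, norm_div, norm_mul, Complex.norm_I,
        Complex.norm_real, Complex.norm_real, Real.norm_of_nonneg hl0.le, Real.norm_eq_abs, hl]
      field_simp
    have hrp : (√(N : ℝ)) ^ (-P.α) = (N : ℝ) ^ (-(P.α / 2)) := by
      rw [Real.sqrt_eq_rpow, ← Real.rpow_mul hN0.le]
      congr 1; ring
    have hw1 : ‖(Complex.I * l) • w - m3.toLp _‖ ≤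
        (√P.a * Real.pi + (4 + P.η)) * (K * (‖c‖ / (P.γκ * (P.a * Real.pi)))) *
          (N : ℝ) ^ (-(P.α / 2)) := by
      calc _ ≤ ‖(Complex.I * l) • w‖ + ‖m3.toLp _‖ := norm_sub_le _ _
        _ ≤ l * ‖w‖ + (4 * N + P.η) * ‖w‖ := by
            gcongr
            rw [norm_smul, norm_mul, Complex.norm_I, one_mul, Complex.norm_real,
              Real.norm_of_nonneg hl0.le]
        _ = (l + (4 * N + P.η)) * ‖w‖ := by ring
        _ ≤ ((√P.a * Real.pi + (4 + P.η)) * N) * (K * (‖c‖ / (P.γκ * (P.a * Real.pi)) *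
              (N : ℝ)⁻¹) * (N : ℝ) ^ (-(P.α / 2))) := by
            gcongr
            · rw [hl]; nlinarith
            · refine hwn.trans ?_
              rw [hrp]
              gcongr
        _ = _ := by field_simp
    rw [hz1, h0, norm_zero]
    have := pow_le_pow_left₀ (norm_nonneg _) hw1 2
    have := mul_le_mul_of_nonneg_left this hk.le
    nlinarith

theorem not_isExponentiallyStable (P : Params) (ha1 : P.a ≠ 1) (T : C0Semigroup (Energy P))
    (hT : T.IsGeneratedBy (waveOp P)) : ¬ T.IsExponentiallyStable := by
  intro h
  obtain ⟨C, hC⟩ := h.exists_norm_le hT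
  obtain ⟨D, E, hDE⟩ := exists_quasimode P ha1
  have hlim : Tendsto (fun N : ℕ => C ^ 2 * (D * ((N : ℝ)⁻¹) ^ 2 +
      E * ((N : ℝ) ^ (-(P.α / 2))) ^ 2)) atTop (𝓝 (C ^ 2 * (D * 0 ^ 2 + E * 0 ^ 2))) := by
    have h1 : Tendsto (fun N : ℕ => (N : ℝ)⁻¹) atTop (𝓝 0) :=
      tendsto_inv_atTop_zero.comp tendsto_natCast_atTop_atTop
    have h2 : Tendsto (fun N : ℕ => (N : ℝ) ^ (-(P.α / 2))) atTop (𝓝 0) :=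
      (tendsto_rpow_neg_atTop (half_pos P.α_pos)).comp tendsto_natCast_atTop_atTop
    exact (((h1.pow 2).const_mul D).add ((h2.pow 2).const_mul E)).const_mul _
  have : (1 / 2 : ℝ) ≤ C ^ 2 * (D * 0 ^ 2 + E * 0 ^ 2) := by
    refine ge_of_tendsto hlim ?_
    filter_upwards [eventually_gt_atTop 0] with N hN
    obtain ⟨l, U, h1, h2⟩ := hDE N hN
    have h3 := pow_le_pow_left₀ (norm_nonneg _) (hC l U) 2
    rw [mul_pow] at h3
    exact h1.trans (h3.trans (by gcongr))
  norm_num at this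

end CoupledWave

theorem theorem3p3 (P : CoupledWave.Params) (ha : P.a ≠ 1) (hSC : P.SC) :
    (∃ T : CoupledWave.C0Semigroup (CoupledWave.Energy P),
      T.IsGeneratedBy (CoupledWave.waveOp P) ∧ T.IsContractive) ∧
    ∀ T : CoupledWave.C0Semigroup (CoupledWave.Energy P),
      T.IsGeneratedBy (CoupledWave.waveOp P) → ¬ T.IsExponentiallyStable :=
  ⟨CoupledWave.exists_waveOp_semigroup P, fun T hT =>
    CoupledWave.not_isExponentiallyStable P ha T hT⟩
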